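/- Let $r_1=\frac{3\sqrt2-\sqrt{10}}8$, $r_2=-\frac{3\sqrt2+\sqrt{10}}8$, and let $\mathfrak g_{r_1,r_2}$ be the $4$-dimensional solvable real Lie algebra with basis $(e_1,e_2,e_3,e_4)$ whose only non-zero brackets, up to antisymmetry, are $$[e_2,e_1]=r_1e_2,\quad [e_3,e_1]=r_2e_3,\quad [e_4,e_1]=(r_1+r_2)e_4,\quad [e_3,e_2]=e_4 .$$ Let $G$ be a simply connected Lie group with Lie algebra $\mathfrak g_{r_1,r_2}$. Regard the $e_i$ as left-invariant vector fields on $G$, let $(e^i)$ be the dual frame of left-invariant $1$-forms, and let $h=\sum_{i=1}^4e^i\otimes e^i$, a left-invariant Riemannian metric with orthonormal frame $(e_i)$. Let $\nabla$, $\rho$, $\tau$ and $W$ be the Levi-Civita connection, Ricci tensor, scalar curvature and Weyl tensor of $h$. Then: 1. The Bach tensor of $h$ vanishes identically: in the orthonormal frame $(e_i)$, for all $i,j$, $$B_{ij}=\sum_{p}\nabla_p\nabla_j\rho_{ip}-\tfrac12\sum_p\nabla_p\nabla_p\rho_{ij}+\tfrac13\tau\rho_{ij}-\sum_p\rho_{pi}\rho_{pj}+\tfrac1{12}\Big(3\sum_{r,s}\rho_{rs}^2-\tau^2\Big)\delta_{ij}=0,$$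 where $\nabla_p\nabla_j\rho_{ik}$ denotes $(\nabla^2_{e_p,e_j}\rho)(e_i,e_k)$ (the derivative in the direction $e_j$ is taken first). 2. $h$ is not half conformally flat: neither the self-dual part $W_+$ nor the anti-self-dual part $W_-$ of $W$ (with respect to the orientation for which $(e_1,e_2,e_3,e_4)$ is positive) vanishes identically. 3. $h$ is not locally conformally Einstein: it is not true that every point of $G$ has an open neighbourhood $U$ with a smooth function $f\colon U\to(0,\infty)$ such that $fh$ is an Einstein metric on $U$ (Ricci tensor equal to a constant multiple of the metric). -/

import Mathlib

open Bundle VectorField Set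
open scoped Manifold ContDiff

/-! Throughout, `M` is a 4-manifold, i.e. a space charted on `EuclideanSpace ℝ (Fin 4)`, with the
model with corners `𝓡 4` (no boundary). -/

/-- The model space of 4-manifolds. -/
abbrev E4 : Type := EuclideanSpace ℝ (Fin 4)

/-- (Not necessarily smooth) vector fields on a 4-manifold `M`. -/
abbrev VField (M : Type*) [TopologicalSpace M] [ChartedSpace E4 M] : Type _ :=
  Π x : M, TangentSpace (𝓡 4) x

/-- Fields of bilinear forms on the tangent spaces of a 4-manifold `M`. -/
abbrev BilinField (M : Type*) [TopologicalSpace M] [ChartedSpace E4 M] : Type _ :=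
  Π x : M, TangentSpace (𝓡 4) x →L[ℝ] TangentSpace (𝓡 4) x →L[ℝ] ℝ

/-- Operators of the type of an affine connection. In Mathlib's argument order, `cov Y x v` is the
covariant derivative `(∇_v Y)(x)`. -/
abbrev ConnOp (M : Type*) [TopologicalSpace M] [ChartedSpace E4 M] : Type _ :=
  VField M → Π x : M, TangentSpace (𝓡 4) x →L[ℝ] TangentSpace (𝓡 4) x

noncomputable section

section Riemannian

variable {M : Type*} [TopologicalSpace M] [ChartedSpace E4 M] [IsManifold (𝓡 4) ∞ M]

/-- `g` is a smooth Riemannian metric on `M`. -/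
def IsRiemannianMetric (g : BilinField M) : Prop :=
  ∃ h : ContMDiffRiemannianMetric (𝓡 4) ∞ E4 (fun x : M => TangentSpace (𝓡 4) x), h.inner = g

/-- The vector field `X` is differentiable at `x`. -/
def DiffFieldAt (X : VField M) (x : M) : Prop :=
  MDifferentiableAt (𝓡 4) (𝓡 4).tangent (fun y => (⟨y, X y⟩ : TangentBundle (𝓡 4) M)) x

/-- The vector field `X` is smooth on `U`. -/
def SmoothFieldOn (X : VField M) (U : Set M) : Prop :=
  ContMDiffOn (𝓡 4) (𝓡 4).tangent ∞ (fun y => (⟨y, X y⟩ : TangentBundle (𝓡 4) M)) U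

/-- `cov` is a Levi-Civita connection of `g` on the open set `U`: it is a covariant derivative,
torsion free, `∇_X Y - ∇_Y X = [X, Y]`, and compatible with the metric,
`v (g(Y, Z)) = g(∇_v Y, Z) + g(Y, ∇_v Z)`. -/
structure IsLeviCivitaOn (g : BilinField M) (cov : ConnOp M) (U : Set M) : Prop where
  isCovariantDerivativeOn : IsCovariantDerivativeOn E4 cov U
  torsion_free : ∀ x ∈ U, ∀ X Y : VField M, DiffFieldAt X x → DiffFieldAt Y x →
    cov Y x (X x) - cov X x (Y x) = mlieBracket (𝓡 4) X Y x
  metric : ∀ x ∈ U, ∀ Y Z : VField M, DiffFieldAt Y x → DiffFieldAt Z x →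
    ∀ v : TangentSpace (𝓡 4) x,
      mvfderiv (𝓡 4) (fun y => g y (Y y) (Z y)) x v =
        g x (cov Y x v) (Z x) + g x (Y x) (cov Z x v)

/-- `e` is a smooth `g`-orthonormal frame on `U`. -/
structure IsOrthonormalFrameOn (g : BilinField M) (e : Fin 4 → VField M) (U : Set M) : Prop where
  smooth : ∀ i, SmoothFieldOn (e i) U
  orthonormal : ∀ x ∈ U, ∀ i j, g x (e i x) (e j x) = if i = j then 1 else 0

/-- The vector field `∇_X Y`. -/
def nabla (cov : ConnOp M) (X Y : VField M) : VField M :=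
  fun x => cov Y x (X x)

/-- The curvature `R(X, Y) Z = ∇_X ∇_Y Z - ∇_Y ∇_X Z - ∇_[X,Y] Z`. -/
def curvature (cov : ConnOp M) (X Y Z : VField M) : VField M :=
  nabla cov X (nabla cov Y Z) - nabla cov Y (nabla cov X Z)
    - nabla cov (mlieBracket (𝓡 4) X Y) Z

/-- The covariant derivative of a 2-tensor `T`, given as a function of vector fields:
`(∇_X T)(Y, Z) = X (T(Y, Z)) - T(∇_X Y, Z) - T(Y, ∇_X Z)`. -/
def covDeriv₂ (cov : ConnOp M) (T : VField M → VField M → M → ℝ)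
    (X Y Z : VField M) (x : M) : ℝ :=
  mvfderiv (𝓡 4) (T Y Z) x (X x) - T (nabla cov X Y) Z x - T Y (nabla cov X Z) x

/-- The covariant derivative of a 3-tensor `T`, given as a function of vector fields. -/
def covDeriv₃ (cov : ConnOp M) (T : VField M → VField M → VField M → M → ℝ)
    (X Y Z V : VField M) (x : M) : ℝ :=
  mvfderiv (𝓡 4) (T Y Z V) x (X x) - T (nabla cov X Y) Z V x - T Y (nabla cov X Z) V x
    - T Y Z (nabla cov X V) x

/-! The curvature quantities below are computed with respect to an orthonormal frame `e` of `g`.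
They are meaningful on the open set where `e` is a smooth orthonormal frame and `cov` is the
Levi-Civita connection. -/

/-- Components of the Riemann tensor, `R_{ijkl} = g(R(e_i, e_j) e_l, e_k)`, so that `R_{ijij}` is
the sectional curvature of the plane spanned by `e_i, e_j`. -/
def riemann (g : BilinField M) (cov : ConnOp M) (e : Fin 4 → VField M)
    (i j k l : Fin 4) (x : M) : ℝ :=
  g x (curvature cov (e i) (e j) (e l) x) (e k x)

/-- The Ricci tensor `ρ(Y, Z) = tr (X ↦ R(X, Y) Z)`. -/
def ricci (g : BilinField M) (cov : ConnOp M) (e : Fin 4 → VField M)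
    (Y Z : VField M) (x : M) : ℝ :=
  ∑ p, g x (curvature cov (e p) Y Z x) (e p x)

/-- The scalar curvature `τ`. -/
def scalarCurv (g : BilinField M) (cov : ConnOp M) (e : Fin 4 → VField M) (x : M) : ℝ :=
  ∑ p, ricci g cov e (e p) (e p) x

/-- `∇∇ρ`; the value at `X, Y, Z, V` is `(∇²_{X,Y} ρ)(Z, V)`, that is
`X^a Y^b Z^c V^d ∇_a ∇_b ρ_{cd}` in index notation. -/
def hessRicci (g : BilinField M) (cov : ConnOp M) (e : Fin 4 → VField M)
    (X Y Z V : VField M) (x : M) : ℝ :=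
  covDeriv₃ cov (covDeriv₂ cov (ricci g cov e)) X Y Z V x

/-- Components of the Bach tensor:
`B_{ij} = ∑_p ∇_p ∇_j ρ_{ip} - 1/2 ∑_p ∇_p ∇_p ρ_{ij} + 1/3 τ ρ_{ij} - ∑_p ρ_{pi} ρ_{pj}
  + 1/12 (3 ∑_{r,s} ρ_{rs}² - τ²) δ_{ij}`. -/
def bach (g : BilinField M) (cov : ConnOp M) (e : Fin 4 → VField M)
    (i j : Fin 4) (x : M) : ℝ :=
  (∑ p, hessRicci g cov e (e p) (e j) (e i) (e p) x)
    - 1 / 2 * (∑ p, hessRicci g cov e (e p) (e p) (e i) (e j) x)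
    + 1 / 3 * scalarCurv g cov e x * ricci g cov e (e i) (e j) x
    - (∑ p, ricci g cov e (e p) (e i) x * ricci g cov e (e p) (e j) x)
    + 1 / 12 * (3 * (∑ r, ∑ s, ricci g cov e (e r) (e s) x ^ 2) - scalarCurv g cov e x ^ 2)
      * (if i = j then 1 else 0)

/-- The Kronecker symbol. -/
def kron (i j : Fin 4) : ℝ := if i = j then 1 else 0

/-- The Levi-Civita symbol: the sign of `(i, j, k, l)` as a permutation of `(0, 1, 2, 3)`, and zero
if two indices agree. -/
def leviCivitaSymbol (i j k l : Fin 4) : ℝ :=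
  Matrix.det (Matrix.of fun a b : Fin 4 => kron (![i, j, k, l] a) b)

/-- Components of the Weyl tensor, the totally trace-free part of the Riemann tensor. -/
def weyl (g : BilinField M) (cov : ConnOp M) (e : Fin 4 → VField M)
    (i j k l : Fin 4) (x : M) : ℝ :=
  riemann g cov e i j k l x
    - 1 / 2 * (kron i k * ricci g cov e (e j) (e l) x - kron i l * ricci g cov e (e j) (e k) x
        - kron j k * ricci g cov e (e i) (e l) x + kron j l * ricci g cov e (e i) (e k) x)
    + 1 / 6 * scalarCurv g cov e x * (kron i k * kron j l - kron i l * kron j k)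

/-- Components of `1/2 (W + s W ∘ ⋆)`, with `⋆` the Hodge star on 2-forms for the orientation in
which the frame `e` is positive. For `s = 1` this is the self-dual part `W₊` of the Weyl tensor, for
`s = -1` the anti-self-dual part `W₋`. -/
def weylHalf (s : ℝ) (g : BilinField M) (cov : ConnOp M) (e : Fin 4 → VField M)
    (i j k l : Fin 4) (x : M) : ℝ :=
  1 / 2 * (weyl g cov e i j k l x
    + s * (1 / 2 * ∑ p, ∑ q, leviCivitaSymbol k l p q * weyl g cov e i j p q x))

/-- The metric `g` is Einstein on the open set `U`: `ρ = c g` for a constant `c`. -/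
def IsEinsteinOn (g : BilinField M) (U : Set M) : Prop :=
  ∃ cov : ConnOp M, IsLeviCivitaOn g cov U ∧
    ∃ c : ℝ, ∀ V : Set M, IsOpen V → V ⊆ U → ∀ e : Fin 4 → VField M,
      IsOrthonormalFrameOn g e V →
        ∀ x ∈ V, ∀ i j, ricci g cov e (e i) (e j) x = c * g x (e i x) (e j x)

/-- `g` is locally conformally Einstein: around each point some metric `f g`, with `f` a positive
smooth function, is Einstein. -/
def IsLocallyConformallyEinstein (g : BilinField M) : Prop :=
  ∀ x : M, ∃ U : Set M, IsOpen U ∧ x ∈ U ∧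
    ∃ f : M → ℝ, ContMDiffOn (𝓡 4) 𝓘(ℝ, ℝ) ∞ f U ∧ (∀ y ∈ U, 0 < f y) ∧
      IsEinsteinOn (fun y => f y • g y) U

end Riemannian

section LieGroup

variable {G : Type*} [TopologicalSpace G] [ChartedSpace E4 G] [Group G]

/-- The Lie algebra of `G` is `𝔤_{α,β}`, and `b = (e₁, e₂, e₃, e₄)` (numbered from `0` here) is its
defining basis: the nonzero brackets are `[e₂, e₁] = α e₂`, `[e₃, e₁] = β e₃`,
`[e₄, e₁] = (α + β) e₄`, `[e₃, e₂] = e₄` and those that follow by antisymmetry. -/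
structure IsStandardBasis (α β : ℝ) (b : Module.Basis (Fin 4) ℝ (GroupLieAlgebra (𝓡 4) G)) :
    Prop where
  lie_10 : ⁅b 1, b 0⁆ = α • b 1
  lie_20 : ⁅b 2, b 0⁆ = β • b 2
  lie_30 : ⁅b 3, b 0⁆ = (α + β) • b 3
  lie_21 : ⁅b 2, b 1⁆ = b 3
  lie_31 : ⁅b 3, b 1⁆ = 0
  lie_32 : ⁅b 3, b 2⁆ = 0

/-- The left-invariant frame on `G` with value `b` at the identity. -/
def leftFrame (b : Module.Basis (Fin 4) ℝ (GroupLieAlgebra (𝓡 4) G)) (i : Fin 4) : VField G :=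
  mulInvariantVectorField (b i)

/-- The left-invariant 1-forms `e^i` on `G` whose values at the identity are the basis dual to `b`:
the value of `e^i` at `v` in `T_x G` is the `i`-th coordinate of the vector in `T_1 G` to which the
left translation by `x⁻¹` takes `v`. -/
def leftCoframe (b : Module.Basis (Fin 4) ℝ (GroupLieAlgebra (𝓡 4) G)) (i : Fin 4) (x : G) :
    TangentSpace (𝓡 4) x →L[ℝ] ℝ :=
  haveI : T2Space (GroupLieAlgebra (𝓡 4) G) := inferInstanceAs (T2Space E4)
  haveI : FiniteDimensional ℝ (GroupLieAlgebra (𝓡 4) G) := b.finiteDimensional_of_finite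
  (LinearMap.toContinuousLinearMap (b.coord i) : GroupLieAlgebra (𝓡 4) G →L[ℝ] ℝ) ∘L
    (mfderiv (𝓡 4) (𝓡 4) (fun y : G => x⁻¹ * y) x :
      TangentSpace (𝓡 4) x →L[ℝ] GroupLieAlgebra (𝓡 4) G)

/-- The left-invariant metric `h = ∑ i, e^i ⊗ e^i` on `G`. -/
def leftMetric (b : Module.Basis (Fin 4) ℝ (GroupLieAlgebra (𝓡 4) G)) : BilinField G :=
  fun x => ∑ i, (leftCoframe b i x).smulRight (leftCoframe b i x)

end LieGroup

end

/-! In a left-invariant orthonormal frame, numbered from 0, the connection and curvature have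
constant components, so the claims about Bach and Weyl are algebra in the structure constants `α`,
`β`. Their values enter only through `α * β = -1/8` and `α ^ 2 + β ^ 2 = 7/8`. The Ricci tensor is
diagonal, and modulo these two relations every Bach component vanishes (`bachCoord_eq_zero`). The
Weyl component W_{0202} is 1/8 and its Hodge-dual partner is β/2, so W₊ = 0 or W₋ = 0 would force β²
= 1/16, which the relations exclude (`weylHalf_leftFrame`).

For the last claim write the conformal factor as f = u⁻². If f h is Einstein, then Hess u = -(u/2) ρ
+ l h for some function l (`exists_conformal_factor_equation`). Differentiating once more and
commuting derivatives gives an integrability condition. For j ≠ 0 the Cotton components C_{iji} that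
are used vanish, and the condition says that W_{ijij} e_j(u) takes the same value for the two chosen
i. The numbers W_{ijij} are 1/8, 1/8 and -1/4, and each chosen pair has different values, so e_1,
e_2, e_3 annihilate u (`eq_zero_of_integrability`). The three diagonal equations along e_1, e_2, e_3
are then linear in e_0(u), u and l, and eliminating gives (β - α) u = 0, impossible since αβ < 0 and
u ≠ 0 (`solvedHess_diag_false`). -/

/-! ### Smooth vector fields and brackets as commutators of derivations. -/

section Manifold

variable {M : Type*} [TopologicalSpace M] [ChartedSpace E4 M] [IsManifold (𝓡 4) ∞ M]

/-- The derivative of a smooth function along a smooth vector field is smooth. -/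
lemma contMDiffAt_mvfderiv_apply {f : M → ℝ} {X : VField M} {x : M}
    (hf : ContMDiffAt (𝓡 4) 𝓘(ℝ, ℝ) ∞ f x)
    (hX : ContMDiffAt (𝓡 4) (𝓡 4).tangent ∞
      (fun y => (⟨y, X y⟩ : TangentBundle (𝓡 4) M)) x) :
    ContMDiffAt (𝓡 4) 𝓘(ℝ, ℝ) ∞ (fun y => mvfderiv (𝓡 4) f y (X y)) x := by
  have h1 := hf.mfderiv_const (m := ∞) le_rfl
  have h2 : ContMDiffAt (𝓡 4) 𝓘(ℝ, ℝ).tangent ∞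
      (fun y => (⟨f y, mfderiv (𝓡 4) 𝓘(ℝ, ℝ) f y (X y)⟩ : TangentBundle 𝓘(ℝ, ℝ) ℝ)) x :=
    ContMDiffAt.clm_apply_of_inCoordinates (b₁ := fun y : M => y) (b₂ := f) h1 hX hf
  exact (contMDiff_snd_tangentBundle_modelSpace ℝ 𝓘(ℝ, ℝ)).contMDiffAt.comp x h2

lemma minSmoothness_two_le : minSmoothness ℝ 2 ≤ (∞ : WithTop ℕ∞) := by
  simp only [minSmoothness_of_isRCLikeNormedField]; exact WithTop.coe_le_coe.2 le_top

/-- A vector field is smooth at `x`. -/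
def SmoothFieldAt (X : VField M) (x : M) : Prop :=
  ContMDiffAt (𝓡 4) (𝓡 4).tangent ∞ (fun y => (⟨y, X y⟩ : TangentBundle (𝓡 4) M)) x

lemma SmoothFieldAt.diffFieldAt {X : VField M} {x : M} (h : SmoothFieldAt X x) :
    DiffFieldAt X x :=
  ContMDiffAt.mdifferentiableAt h (by simp)

lemma SmoothFieldAt.eventually {X : VField M} {x : M} (h : SmoothFieldAt X x) :
    ∀ᶠ y in nhds x, DiffFieldAt X y := by
  have h1 : ContMDiffAt (𝓡 4) (𝓡 4).tangent 1
      (fun y => (⟨y, X y⟩ : TangentBundle (𝓡 4) M)) x := ContMDiffAt.of_le h (by simp)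
  filter_upwards [(contMDiffAt_iff_contMDiffAt_nhds (by simp)).1 h1] with y hy
  exact hy.mdifferentiableAt (by simp)

lemma SmoothFieldAt.mlieBracket {X Y : VField M} {x : M} (hX : SmoothFieldAt X x)
    (hY : SmoothFieldAt Y x) : SmoothFieldAt (mlieBracket (𝓡 4) X Y) x := 
  have : IsManifold (𝓡 4) (((⊤ : ℕ∞) : WithTop ℕ∞) + 1) M :=
    inferInstanceAs (IsManifold (𝓡 4) ∞ M)
  have : IsManifold (𝓡 4) (minSmoothness ℝ 2) M := IsManifold.of_le minSmoothness_two_le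
  ContMDiffAt.mlieBracket_vectorField (m := ⊤) (n := ⊤) hX hY (by simp)

lemma SmoothFieldAt.smul {f : M → ℝ} {X : VField M} {x : M}
    (hf : ContMDiffAt (𝓡 4) 𝓘(ℝ, ℝ) ∞ f x) (hX : SmoothFieldAt X x) :
    SmoothFieldAt (f • X) x :=
  ContMDiffAt.smul_section hf hX

/-- Two applications of the Leibniz rule. The outer bracket only sees the germ of the inner one,
which is why the inner expansion is established near `x`. -/
lemma mlieBracket_mlieBracket_smul {f : M → ℝ} {X Y Z : VField M} {x : M}
    (hf : ContMDiffAt (𝓡 4) 𝓘(ℝ, ℝ) ∞ f x) (hY : SmoothFieldAt Y x) (hZ : SmoothFieldAt Z x) :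
    mlieBracket (𝓡 4) X (mlieBracket (𝓡 4) Y (f • Z)) x =
      mvfderiv (𝓡 4) (fun y => mvfderiv (𝓡 4) f y (Y y)) x (X x) • Z x +
      mvfderiv (𝓡 4) f x (Y x) • mlieBracket (𝓡 4) X Z x +
      mvfderiv (𝓡 4) f x (X x) • mlieBracket (𝓡 4) Y Z x +
      f x • mlieBracket (𝓡 4) X (mlieBracket (𝓡 4) Y Z) x := by
  have hf1 : ContMDiffAt (𝓡 4) 𝓘(ℝ, ℝ) 1 f x := hf.of_le (by simp)
  have hYf := contMDiffAt_mvfderiv_apply hf hY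
  have hev : mlieBracket (𝓡 4) Y (f • Z) =ᶠ[nhds x]
      ((fun y => mvfderiv (𝓡 4) f y (Y y)) • Z + f • mlieBracket (𝓡 4) Y Z : VField M) := by
    filter_upwards [(contMDiffAt_iff_contMDiffAt_nhds (by simp)).1 hf1, hZ.eventually] with y h1 h2
    exact mlieBracket_smul_right (h1.mdifferentiableAt (by simp)) h2
  rw [Filter.EventuallyEq.mlieBracket_vectorField_eq (V₁ := X) (V := X) Filter.EventuallyEq.rfl hev,
    mlieBracket_add_right (hZ.smul hYf).diffFieldAt ((hY.mlieBracket hZ).smul hf).diffFieldAt,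
    mlieBracket_smul_right (hYf.mdifferentiableAt (by simp)) hZ.diffFieldAt,
    mlieBracket_smul_right (hf.mdifferentiableAt (by simp)) (hY.mlieBracket hZ).diffFieldAt]
  abel

/-- A Lie bracket acts on smooth functions as the commutator of derivations. -/
lemma mvfderiv_mlieBracket {f : M → ℝ} {X Y Z : VField M} {x : M}
    (hf : ContMDiffAt (𝓡 4) 𝓘(ℝ, ℝ) ∞ f x) (hX : SmoothFieldAt X x)
    (hY : SmoothFieldAt Y x) (hZ : SmoothFieldAt Z x) (hZx : Z x ≠ 0) :
    mvfderiv (𝓡 4) f x (mlieBracket (𝓡 4) X Y x) =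
      mvfderiv (𝓡 4) (fun y => mvfderiv (𝓡 4) f y (Y y)) x (X x) -
      mvfderiv (𝓡 4) (fun y => mvfderiv (𝓡 4) f y (X y)) x (Y x) := by
  have le {W : VField M} (h : SmoothFieldAt W x) :=
    ContMDiffAt.of_le (show ContMDiffAt _ _ _ _ _ from h) minSmoothness_two_le
  have : IsManifold (𝓡 4) (minSmoothness ℝ 3) M := IsManifold.of_le (n := ∞)
    (by simp only [minSmoothness_of_isRCLikeNormedField]; exact WithTop.coe_le_coe.2 le_top)
  -- The Jacobi identity for `X, Y, f • Z`, minus `f` times the one for `X, Y, Z`, is the desired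
  -- scalar identity multiplied by `Z x`. This is where a field not vanishing at `x` is needed.
  have J1 := leibniz_identity_mlieBracket_apply (le hX) (le hY) (le (hZ.smul hf))
  have J2 := leibniz_identity_mlieBracket_apply (le hX) (le hY) (le hZ)
  rw [mlieBracket_mlieBracket_smul hf hY hZ, mlieBracket_mlieBracket_smul hf hX hZ,
    mlieBracket_smul_right (hf.mdifferentiableAt (by simp)) hZ.diffFieldAt, J2] at J1
  have key : (mvfderiv (𝓡 4) f x (mlieBracket (𝓡 4) X Y x) -
      (mvfderiv (𝓡 4) (fun y => mvfderiv (𝓡 4) f y (Y y)) x (X x) -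
      mvfderiv (𝓡 4) (fun y => mvfderiv (𝓡 4) f y (X y)) x (Y x))) • Z x = 0 := by
    have J3 := sub_eq_zero.2 J1
    rw [← neg_eq_zero, ← J3]
    module
  exact sub_eq_zero.1 ((smul_eq_zero.1 key).resolve_right hZx)

end Manifold

/-! ### Smoothness of left translations and left-invariant fields. -/

section LieGroup

variable {G : Type*} [TopologicalSpace G] [ChartedSpace E4 G] [Group G] [LieGroup (𝓡 4) ∞ G]

/-- The field is the derivative of multiplication at `(g, 1)` applied to `(0, v)`, hence a
composition of the tangent map of multiplication with smooth sections. -/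
lemma contMDiff_mulInvariantVectorField_infty (v : GroupLieAlgebra (𝓡 4) G) :
    ContMDiff (𝓡 4) (𝓡 4).tangent ∞
      (fun g => (⟨g, mulInvariantVectorField v g⟩ : TangentBundle (𝓡 4) G)) := by
  let fg : G → TangentBundle (𝓡 4) G := fun g ↦ TotalSpace.mk' E4 g 0
  have sfg : ContMDiff (𝓡 4) (𝓡 4).tangent ∞ fg := contMDiff_zeroSection _ _
  let fv : G → TangentBundle (𝓡 4) G := fun _ ↦ TotalSpace.mk' E4 1 v
  have sfv : ContMDiff (𝓡 4) (𝓡 4).tangent ∞ fv := contMDiff_const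
  let F₁ : G → (TangentBundle (𝓡 4) G × TangentBundle (𝓡 4) G) := fun g ↦ (fg g, fv g)
  have S₁ : ContMDiff (𝓡 4) ((𝓡 4).tangent.prod (𝓡 4).tangent) ∞ F₁ := sfg.prodMk sfv
  let F₂ : (TangentBundle (𝓡 4) G × TangentBundle (𝓡 4) G) →
      TangentBundle ((𝓡 4).prod (𝓡 4)) (G × G) :=
    (equivTangentBundleProd (𝓡 4) G (𝓡 4) G).symm
  have S₂ : ContMDiff ((𝓡 4).tangent.prod (𝓡 4).tangent) ((𝓡 4).prod (𝓡 4)).tangent ∞ F₂ := contMDiff_equivTangentBundleProd_symm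
  let F₃ : TangentBundle ((𝓡 4).prod (𝓡 4)) (G × G) → TangentBundle (𝓡 4) G :=
    tangentMap ((𝓡 4).prod (𝓡 4)) (𝓡 4) (fun (p : G × G) ↦ p.1 * p.2)
  have S₃ : ContMDiff ((𝓡 4).prod (𝓡 4)).tangent (𝓡 4).tangent ∞ F₃ :=
    ContMDiff.contMDiff_tangentMap (contMDiff_mul (𝓡 4) ∞) (m := ∞) le_rfl
  let S := (S₃.comp S₂).comp S₁
  convert! S with g
  · simp [F₁, F₂, F₃, fg, fv]
  · simp only [Function.comp_apply, tangentMap, F₃, F₂, F₁, fg, fv]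
    rw [mfderiv_prod_eq_add_apply ((contMDiff_mul (𝓡 4) ∞).mdifferentiableAt (by simp))]
    let A : E4 →L[ℝ] E4 := mfderiv (𝓡 4) (𝓡 4) (fun z : G => z * 1) g
    let w : E4 := mulInvariantVectorField v g
    have h : A 0 + w = w := by rw [map_zero, zero_add]
    exact h.symm

/-- The Maurer-Cartan form, i.e. the derivative of left translation to the identity, reads smooth
in coordinates. -/
lemma contMDiffAt_leftTranslation_inCoordinates (x₀ : G) :
    ContMDiffAt (𝓡 4) 𝓘(ℝ, E4 →L[ℝ] E4) ∞
      (inTangentCoordinates (𝓡 4) (𝓡 4) id (fun _ : G => (1 : G))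
        (fun x => mfderiv (𝓡 4) (𝓡 4) (fun y : G => x⁻¹ * y) x) x₀) x₀ := by
  have h : ContMDiff ((𝓡 4).prod (𝓡 4)) (𝓡 4) ∞
      (Function.uncurry fun x y : G => x⁻¹ * y) :=
    (contMDiff_inv (𝓡 4) ∞).comp contMDiff_fst |>.mul contMDiff_snd
  have := ContMDiffAt.mfderiv (m := ∞) (n := ∞) (x₀ := x₀) (fun x y : G => x⁻¹ * y) id
    h.contMDiffAt contMDiffAt_id le_rfl
  simpa using! this

end LieGroup

/-! ### The left-invariant frame, coframe and metric. -/

section LieGroup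

variable {G : Type*} [TopologicalSpace G] [ChartedSpace E4 G] [Group G]

lemma leftCoframe_apply (b : Module.Basis (Fin 4) ℝ (GroupLieAlgebra (𝓡 4) G)) (i : Fin 4)
    (x : G) (v : TangentSpace (𝓡 4) x) :
    leftCoframe b i x v = b.repr (mfderiv (𝓡 4) (𝓡 4) (fun y : G => x⁻¹ * y) x v :) i := rfl

lemma leftMetric_apply (b : Module.Basis (Fin 4) ℝ (GroupLieAlgebra (𝓡 4) G)) (x : G)
    (v w : TangentSpace (𝓡 4) x) :
    leftMetric b x v w = ∑ i, leftCoframe b i x v * leftCoframe b i x w := by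
  have h : leftMetric b x v w =
      ((∑ i, (leftCoframe b i x).smulRight (leftCoframe b i x) :
        TangentSpace (𝓡 4) x →L[ℝ] TangentSpace (𝓡 4) x →L[ℝ] ℝ) v) w := rfl
  rw [h]
  simp

/-- The left-invariant vector field with coordinates `a` in the basis `b`. -/
noncomputable def leftField (b : Module.Basis (Fin 4) ℝ (GroupLieAlgebra (𝓡 4) G))
    (a : Fin 4 → ℝ) : VField G :=
  mulInvariantVectorField (∑ i, a i • b i)

variable (b : Module.Basis (Fin 4) ℝ (GroupLieAlgebra (𝓡 4) G))

lemma leftFrame_eq_leftField (i : Fin 4) : leftFrame b i = leftField b (Pi.single i 1) := by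
  unfold leftFrame leftField
  congr 1
  simp [Pi.single_apply]

lemma leftField_apply (a : Fin 4 → ℝ) (x : G) :
    leftField b a x = ∑ i, a i • leftFrame b i x := by
  have h : leftField b a x = mfderiv (𝓡 4) (𝓡 4) (fun y : G => x * y) 1 (∑ i, a i • b i) := rfl
  rw [h, map_sum]
  simp only [map_smul]
  simp only [leftFrame, mulInvariantVectorField]
  rfl

variable [LieGroup (𝓡 4) ∞ G]

/-- Both sides are read in `E4` because their base points `x * (y * z)` and `x * y * z` agree only
propositionally. -/
lemma mfderiv_mul_left_comp (x y z : G) (v : TangentSpace (𝓡 4) z) :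
    (mfderiv (𝓡 4) (𝓡 4) (fun w : G => x * w) (y * z)
      (mfderiv (𝓡 4) (𝓡 4) (fun w : G => y * w) z v : E4) : E4) =
    (mfderiv (𝓡 4) (𝓡 4) (fun w : G => x * y * w) z v : E4) := by
  have h (a c : G) : MDifferentiableAt (𝓡 4) (𝓡 4) (fun w : G => a * w) c :=
    (contMDiff_mul_left (I := 𝓡 4) (n := ∞)).contMDiffAt.mdifferentiableAt (by simp)
  have := mfderiv_comp (I := 𝓡 4) (I' := 𝓡 4) (I'' := 𝓡 4) z (h x (y * z)) (h y z)
  have e : (fun w : G => x * w) ∘ (fun w => y * w) = fun w => x * y * w := by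
    ext w; simp [mul_assoc]
  rw [e] at this
  rw [this]; rfl

lemma leftCoframe_mulInvariantVectorField (i : Fin 4) (x : G) (v : GroupLieAlgebra (𝓡 4) G) :
    leftCoframe b i x (mulInvariantVectorField v x) = b.repr v i := by
  have h := mfderiv_mul_left_comp x⁻¹ x 1 v
  have e : (fun w : G => x⁻¹ * x * w) = id := by ext; simp
  rw [e, mfderiv_id, mul_one] at h
  rw [leftCoframe_apply]
  exact congrArg (fun u : GroupLieAlgebra (𝓡 4) G => b.repr u i) h

lemma mulInvariantVectorField_surjective (x : G) (v : TangentSpace (𝓡 4) x) :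
    ∃ w : GroupLieAlgebra (𝓡 4) G, mulInvariantVectorField w x = v := by
  have h := mfderiv_mul_left_comp x x⁻¹ x v
  have e : (fun w : G => x * x⁻¹ * w) = id := by ext; simp
  rw [e, mfderiv_id, inv_mul_cancel] at h
  exact ⟨_, h⟩

lemma leftCoframe_leftField (i : Fin 4) (a : Fin 4 → ℝ) (x : G) :
    leftCoframe b i x (leftField b a x) = a i := by
  rw [leftField, leftCoframe_mulInvariantVectorField]
  simp [Finsupp.single_apply]

lemma leftCoframe_leftFrame (i j : Fin 4) (x : G) :
    leftCoframe b i x (leftFrame b j x) = if i = j then 1 else 0 := by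
  rw [leftFrame_eq_leftField, leftCoframe_leftField, Pi.single_apply]

lemma sum_leftCoframe_smul_leftFrame (x : G) (v : TangentSpace (𝓡 4) x) :
    ∑ i, leftCoframe b i x v • leftFrame b i x = v := by
  obtain ⟨w, rfl⟩ := mulInvariantVectorField_surjective x v
  simp only [leftCoframe_mulInvariantVectorField]
  rw [← leftField_apply b (fun i => b.repr w i), leftField, b.sum_repr]

lemma smoothFieldAt_leftFrame (i : Fin 4) (x : G) : SmoothFieldAt (leftFrame b i) x :=
  (contMDiff_mulInvariantVectorField_infty (b i)).contMDiffAt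

lemma smoothFieldAt_leftField (a : Fin 4 → ℝ) (x : G) : SmoothFieldAt (leftField b a) x :=
  (contMDiff_mulInvariantVectorField_infty (∑ i, a i • b i)).contMDiffAt

lemma leftMetric_leftField (x : G) (a c : Fin 4 → ℝ) :
    leftMetric b x (leftField b a x) (leftField b c x) = ∑ i, a i * c i := by
  simp only [leftMetric_apply, leftCoframe_leftField]

lemma isOrthonormalFrameOn_leftFrame :
    IsOrthonormalFrameOn (leftMetric b) (leftFrame b) univ where
  smooth i x _ := (smoothFieldAt_leftFrame b i x).contMDiffWithinAt
  orthonormal x _ i j := by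
    simp [leftMetric_apply, leftCoframe_leftFrame, eq_comm]

/-- The coframe, read in the trivialization of the tangent bundle at `x₀`, is smooth. -/
lemma contMDiffAt_leftCoframe_comp_symmL (i : Fin 4) (x₀ : G) :
    ContMDiffAt (𝓡 4) 𝓘(ℝ, E4 →L[ℝ] ℝ) ∞
      (fun x => ((leftCoframe b i x).comp
        ((trivializationAt E4 (TangentSpace (𝓡 4) : G → Type _) x₀).symmL ℝ x) :
          E4 →L[ℝ] ℝ)) x₀ := by
  have hT : T2Space (GroupLieAlgebra (𝓡 4) G) := inferInstanceAs (T2Space E4)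
  have hF : FiniteDimensional ℝ (GroupLieAlgebra (𝓡 4) G) := b.finiteDimensional_of_finite
  let e := trivializationAt E4 (TangentSpace (𝓡 4) : G → Type _) 1
  let L : E4 →L[ℝ] ℝ := (LinearMap.toContinuousLinearMap (b.coord i) :
    GroupLieAlgebra (𝓡 4) G →L[ℝ] ℝ).comp (e.symmL ℝ 1)
  have h1 := contMDiffAt_leftTranslation_inCoordinates x₀
  have h2 : ContMDiffAt (𝓡 4) 𝓘(ℝ, E4 →L[ℝ] ℝ) ∞ (fun x => L.comp
      (inTangentCoordinates (𝓡 4) (𝓡 4) id (fun _ : G => (1 : G))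
        (fun x => mfderiv (𝓡 4) (𝓡 4) (fun y : G => x⁻¹ * y) x) x₀ x)) x₀ :=
    contMDiffAt_const.clm_comp h1
  refine h2.congr_of_eventuallyEq (Filter.Eventually.of_forall fun x => ?_)
  ext v
  -- The values of the Maurer-Cartan form all lie over `1`, so the trivialization there cancels
  -- against its inverse inside `L`.
  have hm : (1 : G) ∈ e.baseSet := FiberBundle.mem_baseSet_trivializationAt' 1
  exact (congrArg (fun u : GroupLieAlgebra (𝓡 4) G => b.coord i u)
    (e.symmL_continuousLinearMapAt (R := ℝ) hm _)).symm

set_option synthInstance.maxHeartbeats 200000 in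
set_option maxHeartbeats 800000 in
lemma isRiemannianMetric_leftMetric : IsRiemannianMetric (leftMetric b) := by
  have hpos (x : G) (v : TangentSpace (𝓡 4) x) (hv : v ≠ 0) : 0 < leftMetric b x v v := by
    rw [leftMetric_apply]
    have hnn : ∀ i ∈ Finset.univ, 0 ≤ leftCoframe b i x v * leftCoframe b i x v :=
      fun i _ => mul_self_nonneg _
    refine (Finset.sum_nonneg hnn).lt_of_ne fun h => hv ?_
    rw [← sum_leftCoframe_smul_leftFrame b x v]
    refine Finset.sum_eq_zero fun i hi => ?_
    rw [mul_self_eq_zero.1 ((Finset.sum_eq_zero_iff_of_nonneg hnn).1 h.symm i hi), zero_smul]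
  have hbd (x : G) : Bornology.IsVonNBounded ℝ
      {v : TangentSpace (𝓡 4) x | leftMetric b x v v < 1} := by
    -- The unit ball of the metric lies in the image under `L` of a bounded ball: all its coframe
    -- coordinates are at most 1 in absolute value.
    let L : (Fin 4 → ℝ) →L[ℝ] TangentSpace (𝓡 4) x :=
      ∑ i, (ContinuousLinearMap.proj (R := ℝ) (φ := fun _ : Fin 4 => ℝ) i).smulRight
        (leftFrame b i x)
    refine ((NormedSpace.isVonNBounded_ball ℝ (Fin 4 → ℝ) 2).image L).subset fun v hv => ?_
    refine ⟨fun i => leftCoframe b i x v, ?_, ?_⟩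
    · rw [mem_ball_zero_iff]
      refine lt_of_le_of_lt ((pi_norm_le_iff_of_nonneg zero_le_one).2 fun i => ?_) one_lt_two
      rw [mem_ofPred_eq, leftMetric_apply] at hv
      have := Finset.single_le_sum (f := fun i => leftCoframe b i x v * leftCoframe b i x v)
        (fun i _ => mul_self_nonneg _) (Finset.mem_univ i)
      rw [Real.norm_eq_abs, abs_le_one_iff_mul_self_le_one]
      linarith
    · simpa [L] using sum_leftCoframe_smul_leftFrame b x v
  refine ⟨⟨leftMetric b, fun x v w => ?_, hpos, hbd, fun x₀ => ?_⟩, rfl⟩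
  · simp only [leftMetric_apply, mul_comm]
  · rw [contMDiffAt_hom_bundle]
    refine ⟨contMDiffAt_id, ?_⟩
    let e := trivializationAt E4 (TangentSpace (𝓡 4) : G → Type _) x₀
    let φ (i : Fin 4) (x : G) : E4 →L[ℝ] ℝ := (leftCoframe b i x).comp (e.symmL ℝ x)
    have h : ContMDiffAt (𝓡 4) 𝓘(ℝ, E4 →L[ℝ] E4 →L[ℝ] ℝ) ∞
        (fun x => ∑ i, ContinuousLinearMap.smulRightL ℝ E4 (E4 →L[ℝ] ℝ) (φ i x) (φ i x)) x₀ := by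
      refine ContMDiffAt.sum fun i _ => ?_
      have hφ := contMDiffAt_leftCoframe_comp_symmL b i x₀
      exact ((ContinuousLinearMap.contMDiff _).contMDiffAt.comp x₀ hφ).clm_apply hφ
    refine h.congr_of_eventuallyEq ?_
    filter_upwards [e.open_baseSet.mem_nhds (FiberBundle.mem_baseSet_trivializationAt' x₀)]
      with x hx
    ext v w
    refine (inCoordinates_apply_eq₂ hx hx (Set.mem_univ _)).trans ?_
    rw [← e.symmL_apply (R := ℝ) hx, ← e.symmL_apply (R := ℝ) hx]
    have h0 (c : ℝ) : (trivializationAt ℝ (Bundle.Trivial G ℝ) x₀).linearMapAt ℝ x c = c := by simp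
    refine (h0 _).trans ((leftMetric_apply b x _ _).trans ?_)
    simp [φ]

lemma mdifferentiableAt_leftCoframe_apply (i : Fin 4) {X : VField G} {x : G}
    (hX : DiffFieldAt X x) :
    MDifferentiableAt (𝓡 4) 𝓘(ℝ, ℝ) (fun y => leftCoframe b i y (X y)) x := by
  let e := trivializationAt E4 (TangentSpace (𝓡 4) : G → Type _) x
  refine (((contMDiffAt_leftCoframe_comp_symmL b i x).mdifferentiableAt (by simp)).clm_apply
    (mdifferentiableAt_totalSpace .. |>.1 hX).2).congr_of_eventuallyEq ?_
  filter_upwards [e.open_baseSet.mem_nhds (FiberBundle.mem_baseSet_trivializationAt' x)] with y hy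
  exact congrArg (leftCoframe b i y) ((e.symmL_apply (R := ℝ) hy _).trans
    (e.symm_apply_apply_mk hy (X y))).symm

end LieGroup

/-! ### Derivatives of finite sums. -/

section Manifold

variable {M : Type*} [TopologicalSpace M] [ChartedSpace E4 M]

lemma mdifferentiableAt_fun_sum {ι : Type*} {s : Finset ι} {f : ι → M → ℝ} {x : M}
    (hf : ∀ i ∈ s, MDifferentiableAt (𝓡 4) 𝓘(ℝ, ℝ) (f i) x) :
    MDifferentiableAt (𝓡 4) 𝓘(ℝ, ℝ) (fun y => ∑ i ∈ s, f i y) x := by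
  classical
  induction s using Finset.induction_on with
  | empty => simpa using mdifferentiableAt_const
  | insert a s ha ih =>
    simp only [Finset.mem_insert, forall_eq_or_imp] at hf
    simp only [Finset.sum_insert ha]
    exact hf.1.add (ih hf.2)

lemma mvfderiv_fun_sum {ι : Type*} {s : Finset ι} {f : ι → M → ℝ} {x : M}
    (hf : ∀ i ∈ s, MDifferentiableAt (𝓡 4) 𝓘(ℝ, ℝ) (f i) x) :
    mvfderiv (𝓡 4) (fun y => ∑ i ∈ s, f i y) x = ∑ i ∈ s, mvfderiv (𝓡 4) (f i) x := by
  classical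
  induction s using Finset.induction_on with
  | empty => simp [mvfderiv_const]
  | insert a s ha ih =>
    simp only [Finset.mem_insert, forall_eq_or_imp] at hf
    simp only [Finset.sum_insert ha]
    rw [mvfderiv_fun_add hf.1 (mdifferentiableAt_fun_sum hf.2), ih hf.2]

end Manifold

/-! ### Bracket, connection and curvature as algebra on coordinate vectors. -/

section Coordinates

/-- The Lie bracket of `𝔤_{α,β}` in coordinates. -/
def lieCoord (α β : ℝ) (a c : Fin 4 → ℝ) : Fin 4 → ℝ :=
  ![0, α * (a 1 * c 0 - a 0 * c 1), β * (a 2 * c 0 - a 0 * c 2),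
    (α + β) * (a 3 * c 0 - a 0 * c 3) + (a 2 * c 1 - a 1 * c 2)]

/-- The Levi-Civita connection of `𝔤_{α,β}` in coordinates. -/
noncomputable def connCoord (α β : ℝ) (a c : Fin 4 → ℝ) : Fin 4 → ℝ :=
  ![-α * (a 1 * c 1) - β * (a 2 * c 2) - (α + β) * (a 3 * c 3),
    α * (a 1 * c 0) - 1 / 2 * (a 2 * c 3) - 1 / 2 * (a 3 * c 2),
    β * (a 2 * c 0) + 1 / 2 * (a 1 * c 3) + 1 / 2 * (a 3 * c 1),
    (α + β) * (a 3 * c 0) - 1 / 2 * (a 1 * c 2) + 1 / 2 * (a 2 * c 1)]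

/-- The curvature of `𝔤_{α,β}` in coordinates. -/
noncomputable def curvCoord (α β : ℝ) (a c d : Fin 4 → ℝ) : Fin 4 → ℝ :=
  connCoord α β a (connCoord α β c d) - connCoord α β c (connCoord α β a d)
    - connCoord α β (lieCoord α β a c) d

/-- The eigenvalues of the Ricci tensor of `𝔤_{α,β}`. -/
noncomputable def ricciEigenvalue (α β : ℝ) : Fin 4 → ℝ :=
  ![-(α ^ 2 + β ^ 2 + (α + β) ^ 2), -2 * (α + β) * α - 1 / 2, -2 * (α + β) * β - 1 / 2,
    -2 * (α + β) ^ 2 + 1 / 2]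

/-- The frame diagonalizes Ricci: reversing the signs of `b 1` and `b 2` independently, and that of
`b 3` by their product, gives isometric automorphisms, which rule out off-diagonal entries. -/
lemma sum_curvCoord (α β : ℝ) (a c : Fin 4 → ℝ) :
    ∑ p, curvCoord α β (Pi.single p 1) a c p = ∑ p, ricciEigenvalue α β p * (a p * c p) := by
  simp [Fin.sum_univ_four, curvCoord, connCoord, lieCoord, ricciEigenvalue, Pi.single_apply]
  ring

lemma connCoord_sub_connCoord (α β : ℝ) (a c : Fin 4 → ℝ) :
    connCoord α β a c - connCoord α β c a = lieCoord α β a c := by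
  ext k
  fin_cases k <;> simp [connCoord, lieCoord] <;> ring

lemma connCoord_add_right (α β : ℝ) (a c c' : Fin 4 → ℝ) :
    connCoord α β a (c + c') = connCoord α β a c + connCoord α β a c' := by
  ext k
  fin_cases k <;> simp [connCoord] <;> ring

lemma connCoord_smul_right (α β r : ℝ) (a c : Fin 4 → ℝ) :
    connCoord α β a (r • c) = r • connCoord α β a c := by
  ext k
  fin_cases k <;> simp [connCoord] <;> ring

lemma sum_connCoord_mul (α β : ℝ) (a c d : Fin 4 → ℝ) :
    ∑ k, (connCoord α β a c k * d k + c k * connCoord α β a d k) = 0 := by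
  simp [Fin.sum_univ_four, connCoord]
  ring

lemma sum_smul_connCoord_single (α β : ℝ) (a c : Fin 4 → ℝ) (k : Fin 4) :
    ∑ i, connCoord α β (Pi.single i 1) c k * a i = connCoord α β a c k := by
  fin_cases k <;> simp [Fin.sum_univ_four, connCoord] <;> ring

end Coordinates

/-! ### The Levi-Civita connection and Ricci tensor of the left-invariant metric. -/

section LieGroup

variable {G : Type*} [TopologicalSpace G] [ChartedSpace E4 G] [Group G] [LieGroup (𝓡 4) ∞ G]
  {α β : ℝ} {b : Module.Basis (Fin 4) ℝ (GroupLieAlgebra (𝓡 4) G)}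

lemma mlieBracket_leftField (hb : IsStandardBasis α β b) (a c : Fin 4 → ℝ) :
    mlieBracket (𝓡 4) (leftField b a) (leftField b c) = leftField b (lieCoord α β a c) := by
  have : LieGroup (𝓡 4) (minSmoothness ℝ 3) G := LieGroup.of_le (n := ∞)
    (by simp only [minSmoothness_of_isRCLikeNormedField]; exact WithTop.coe_le_coe.2 le_top)
  have h : ⁅∑ i, a i • b i, ∑ i, c i • b i⁆ = ∑ i, lieCoord α β a c i • b i := by
    have h01 : ⁅b 0, b 1⁆ = -(α • b 1) := by rw [← hb.lie_10, lie_skew]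
    have h02 : ⁅b 0, b 2⁆ = -(β • b 2) := by rw [← hb.lie_20, lie_skew]
    have h03 : ⁅b 0, b 3⁆ = -((α + β) • b 3) := by rw [← hb.lie_30, lie_skew]
    have h12 : ⁅b 1, b 2⁆ = -b 3 := by rw [← hb.lie_21, lie_skew]
    have h13 : ⁅b 1, b 3⁆ = 0 := by rw [← lie_skew, hb.lie_31, neg_zero]
    have h23 : ⁅b 2, b 3⁆ = 0 := by rw [← lie_skew, hb.lie_32, neg_zero]
    simp only [Fin.sum_univ_four, add_lie, lie_add, smul_lie, lie_smul, lie_self, hb.lie_10,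
      hb.lie_20, hb.lie_30, hb.lie_21, hb.lie_31, hb.lie_32, h01, h02, h03, h12, h13, h23]
    simp [lieCoord]
    module
  rw [leftField, leftField, ← mulInvariantVector_mlieBracket, leftField, ← h]
  rfl

variable (b) in
lemma eq_of_leftCoframe_eq {x : G} {v w : TangentSpace (𝓡 4) x}
    (h : ∀ k, leftCoframe b k x v = leftCoframe b k x w) : v = w := by
  rw [← sum_leftCoframe_smul_leftFrame b x v, ← sum_leftCoframe_smul_leftFrame b x w]
  simp only [h]

variable (b) in
lemma leftField_leftCoframe {x : G} (v : TangentSpace (𝓡 4) x) :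
    leftField b (fun k => leftCoframe b k x v) x = v :=
  eq_of_leftCoframe_eq b fun k => leftCoframe_leftField b k _ x

lemma leftField_sub (a c : Fin 4 → ℝ) : leftField b a - leftField b c = leftField b (a - c) := by
  ext1 x
  refine eq_of_leftCoframe_eq b fun k => ?_
  rw [Pi.sub_apply, map_sub]
  simp only [leftCoframe_leftField, Pi.sub_apply]

variable (α β b) in
/-- The Levi-Civita connection of the left-invariant metric. -/
noncomputable def leftConn : ConnOp G := fun Y x =>
  ∑ k, (mvfderiv (𝓡 4) (fun y => leftCoframe b k y (Y y)) x +
    ∑ i, connCoord α β (Pi.single i 1) (fun j => leftCoframe b j x (Y x)) k •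
      leftCoframe b i x).smulRight (leftFrame b k x)

lemma leftCoframe_leftConn (Y : VField G) (x : G) (v : TangentSpace (𝓡 4) x) (k : Fin 4) :
    leftCoframe b k x (leftConn α β b Y x v) =
      mvfderiv (𝓡 4) (fun y => leftCoframe b k y (Y y)) x v +
      connCoord α β (fun i => leftCoframe b i x v) (fun i => leftCoframe b i x (Y x)) k := by
  simp [leftConn, leftCoframe_leftFrame, ← sum_smul_connCoord_single α β
    (fun i => leftCoframe b i x v)]

/-- Constant coframe components have zero derivative, so on left-invariant fields only the algebraic
part of the connection survives. Curvature computations thereby reduce to `connCoord` and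
`lieCoord`. -/
lemma nabla_leftConn_leftField (a c : Fin 4 → ℝ) :
    nabla (leftConn α β b) (leftField b a) (leftField b c) = leftField b (connCoord α β a c) := by
  ext1 x
  refine eq_of_leftCoframe_eq b fun k => ?_
  rw [nabla, leftCoframe_leftConn]
  simp only [leftCoframe_leftField, mvfderiv_const]
  simp

lemma isCovariantDerivativeOn_leftConn :
    IsCovariantDerivativeOn E4 (leftConn α β b) univ where
  add {X Y x} hX hY _ := by
    ext1 v
    refine eq_of_leftCoframe_eq b fun k => ?_
    have h1 := mdifferentiableAt_leftCoframe_apply b k hX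
    have h2 := mdifferentiableAt_leftCoframe_apply b k hY
    have h3 : (fun i => leftCoframe b i x ((X + Y) x)) =
      (fun i => leftCoframe b i x (X x)) + (fun i => leftCoframe b i x (Y x)) := by
      ext i; simp
    rw [add_apply, map_add]
    simp only [leftCoframe_leftConn]
    rw [h3, connCoord_add_right]
    simp only [Pi.add_apply, map_add]
    rw [mvfderiv_fun_add h1 h2]
    simp
    ring
  leibniz {X f x} hX hf _ := by
    ext1 v
    refine eq_of_leftCoframe_eq b fun k => ?_
    have h1 := mdifferentiableAt_leftCoframe_apply b k hX
    have h3 : (fun i => leftCoframe b i x ((f • X) x)) =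
      f x • (fun i => leftCoframe b i x (X x)) := by
      ext i; simp
    rw [add_apply, map_add, smul_apply, map_smul]
    simp only [leftCoframe_leftConn]
    rw [h3, connCoord_smul_right]
    simp only [Pi.smul_apply', map_smul, smul_eq_mul]
    rw [mvfderiv_fun_mul hf h1]
    simp
    ring

lemma isLeviCivitaOn_leftConn (hb : IsStandardBasis α β b) :
    IsLeviCivitaOn (leftMetric b) (leftConn α β b) univ where
  isCovariantDerivativeOn := isCovariantDerivativeOn_leftConn
  torsion_free x _ X Y hX hY := by
    have hcov := isCovariantDerivativeOn_leftConn (α := α) (β := β) (b := b)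
    -- Torsion is tensorial, so it may be tested on the left-invariant extensions of `v` and `w`.
    have h0 (v w : TangentSpace (𝓡 4) x) : hcov.torsion x v w = 0 := by
      rw [← leftField_leftCoframe b v, ← leftField_leftCoframe b w,
        hcov.torsion_apply (smoothFieldAt_leftField b _ x).diffFieldAt
          (smoothFieldAt_leftField b _ x).diffFieldAt, mlieBracket_leftField hb,
        ← connCoord_sub_connCoord, ← leftField_sub, ← nabla_leftConn_leftField,
        ← nabla_leftConn_leftField]
      simp [nabla]
    rw [← sub_eq_zero, ← hcov.torsion_apply hX hY, h0]
  metric x _ Y Z hY hZ v := by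
    have h1 (k : Fin 4) := mdifferentiableAt_leftCoframe_apply b k hY
    have h2 (k : Fin 4) := mdifferentiableAt_leftCoframe_apply b k hZ
    have h3 := sum_connCoord_mul α β (fun i => leftCoframe b i x v)
      (fun i => leftCoframe b i x (Y x)) (fun i => leftCoframe b i x (Z x))
    simp only [leftMetric_apply, leftCoframe_leftConn]
    have h4 (k : Fin 4) (_ : k ∈ Finset.univ) : MDifferentiableAt (𝓡 4) 𝓘(ℝ, ℝ)
        (fun y => leftCoframe b k y (Y y) * leftCoframe b k y (Z y)) x := (h1 k).mul (h2 k)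
    rw [mvfderiv_fun_sum h4, sum_apply, ← Finset.sum_add_distrib,
      ← sub_eq_zero, ← Finset.sum_sub_distrib, ← neg_eq_zero, ← Finset.sum_neg_distrib, ← h3]
    refine Finset.sum_congr rfl fun k _ => ?_
    rw [mvfderiv_fun_mul (h1 k) (h2 k), add_apply, smul_apply, smul_apply, smul_eq_mul,
      smul_eq_mul]
    ring

lemma curvature_leftConn_leftField (hb : IsStandardBasis α β b) (a c d : Fin 4 → ℝ) :
    curvature (leftConn α β b) (leftField b a) (leftField b c) (leftField b d) =
      leftField b (curvCoord α β a c d) := by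
  simp only [curvature, mlieBracket_leftField hb, nabla_leftConn_leftField, leftField_sub,
    curvCoord]

lemma ricci_leftField (hb : IsStandardBasis α β b) (a c : Fin 4 → ℝ) (x : G) :
    ricci (leftMetric b) (leftConn α β b) (leftFrame b) (leftField b a) (leftField b c) x =
      ∑ p, ricciEigenvalue α β p * (a p * c p) := by
  rw [← sum_curvCoord, ricci]
  simp only [leftFrame_eq_leftField, curvature_leftConn_leftField hb, leftMetric_leftField]
  simp [Pi.single_apply]

/-- The covariant derivative of the Ricci tensor in coordinates. -/
noncomputable def derivRicciCoord (α β : ℝ) (a c d : Fin 4 → ℝ) : ℝ :=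
  -(∑ p, ricciEigenvalue α β p * (connCoord α β a c p * d p))
    - ∑ p, ricciEigenvalue α β p * (c p * connCoord α β a d p)

/-- The second covariant derivative of the Ricci tensor in coordinates. -/
noncomputable def hessRicciCoord (α β : ℝ) (a c d e : Fin 4 → ℝ) : ℝ :=
  -derivRicciCoord α β (connCoord α β a c) d e - derivRicciCoord α β c (connCoord α β a d) e
    - derivRicciCoord α β c d (connCoord α β a e)

lemma hessRicci_leftField (hb : IsStandardBasis α β b) (a c d e : Fin 4 → ℝ) (x : G) :
    hessRicci (leftMetric b) (leftConn α β b) (leftFrame b) (leftField b a) (leftField b c)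
      (leftField b d) (leftField b e) x = hessRicciCoord α β a c d e := by
  have h2 (a c d : Fin 4 → ℝ) :
      covDeriv₂ (leftConn α β b) (ricci (leftMetric b) (leftConn α β b) (leftFrame b))
        (leftField b a) (leftField b c) (leftField b d) = fun _ => derivRicciCoord α β a c d := by
    ext x
    have h : ricci (leftMetric b) (leftConn α β b) (leftFrame b) (leftField b c) (leftField b d)
      = fun _ => ∑ p, ricciEigenvalue α β p * (c p * d p) := funext (ricci_leftField hb c d)
    simp only [covDeriv₂, nabla_leftConn_leftField, ricci_leftField hb, derivRicciCoord]
    rw [h, mvfderiv_const]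
    simp
  simp only [hessRicci, covDeriv₃, nabla_leftConn_leftField, h2, mvfderiv_const, hessRicciCoord]
  simp

end LieGroup

/-! ### Vanishing of the Bach tensor and non-vanishing of both Weyl halves. -/

section LieGroup

/-- As the connection matrices are skew and Ricci is diagonal, only differences of Ricci eigenvalues
enter. This form keeps the second derivatives in the Bach tensor manageable. -/
lemma derivRicciCoord_eq (α β : ℝ) (a c d : Fin 4 → ℝ) :
    derivRicciCoord α β a c d =
      α * (ricciEigenvalue α β 0 - ricciEigenvalue α β 1) * a 1 * (c 1 * d 0 + c 0 * d 1) +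
      β * (ricciEigenvalue α β 0 - ricciEigenvalue α β 2) * a 2 * (c 2 * d 0 + c 0 * d 2) +
      (α + β) * (ricciEigenvalue α β 0 - ricciEigenvalue α β 3) * a 3 *
        (c 3 * d 0 + c 0 * d 3) +
      1 / 2 * (ricciEigenvalue α β 1 - ricciEigenvalue α β 2) * a 3 * (c 2 * d 1 + c 1 * d 2) +
      1 / 2 * (ricciEigenvalue α β 1 - ricciEigenvalue α β 3) * a 2 * (c 3 * d 1 + c 1 * d 3) +
      1 / 2 * (ricciEigenvalue α β 3 - ricciEigenvalue α β 2) * a 1 *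
        (c 3 * d 2 + c 2 * d 3) := by
  simp only [derivRicciCoord, Fin.sum_univ_four, connCoord, Matrix.cons_val]
  ring

/-- The Bach tensor in coordinates. -/
noncomputable def bachCoord (α β : ℝ) (i j : Fin 4) : ℝ :=
  (∑ p, hessRicciCoord α β (Pi.single p 1) (Pi.single j 1) (Pi.single i 1) (Pi.single p 1))
    - 1 / 2 * (∑ p, hessRicciCoord α β (Pi.single p 1) (Pi.single p 1) (Pi.single i 1)
        (Pi.single j 1))
    + 1 / 3 * (∑ p, ricciEigenvalue α β p) * (if i = j then ricciEigenvalue α β i else 0)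
    - (if i = j then ricciEigenvalue α β i ^ 2 else 0)
    + 1 / 12 * (3 * (∑ p, ricciEigenvalue α β p ^ 2) - (∑ p, ricciEigenvalue α β p) ^ 2)
      * (if i = j then 1 else 0)

-- The two relations make each eigenvalue a constant or a polynomial in `α ^ 2`. Each of the 16
-- entries then vanishes modulo the relations.
set_option maxHeartbeats 4000000 in
lemma bachCoord_eq_zero {α β : ℝ} (h₁ : α * β = -1 / 8) (h₂ : α ^ 2 + β ^ 2 = 7 / 8)
    (i j : Fin 4) : bachCoord α β i j = 0 := by
  have e0 : ricciEigenvalue α β 0 = -3 / 2 := by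
    simp [ricciEigenvalue]; linear_combination -2 * h₂ - 2 * h₁
  have e1 : ricciEigenvalue α β 1 = -2 * α ^ 2 - 1 / 4 := by
    simp [ricciEigenvalue]; linear_combination -2 * h₁
  have e2 : ricciEigenvalue α β 2 = 2 * α ^ 2 - 2 := by
    simp [ricciEigenvalue]; linear_combination -2 * h₁ - 2 * h₂
  have e3 : ricciEigenvalue α β 3 = -3 / 4 := by
    simp [ricciEigenvalue]; linear_combination -4 * h₁ - 2 * h₂
  simp only [bachCoord, Fin.sum_univ_four, hessRicciCoord, derivRicciCoord_eq, e0, e1, e2, e3]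
  fin_cases i <;> fin_cases j <;>
    simp [connCoord, e0, e1, e2, e3] <;> grind

variable {G : Type*} [TopologicalSpace G] [ChartedSpace E4 G] [Group G] [LieGroup (𝓡 4) ∞ G]
  {α β : ℝ} {b : Module.Basis (Fin 4) ℝ (GroupLieAlgebra (𝓡 4) G)}

lemma ricci_leftFrame (hb : IsStandardBasis α β b) (i j : Fin 4) (x : G) :
    ricci (leftMetric b) (leftConn α β b) (leftFrame b) (leftFrame b i) (leftFrame b j) x =
      if i = j then ricciEigenvalue α β i else 0 := by
  rw [leftFrame_eq_leftField b i, leftFrame_eq_leftField b j, ricci_leftField hb]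
  rcases eq_or_ne i j with rfl | h
  · simp [Pi.single_apply]
  · simp [Pi.single_apply, h, h.symm]

lemma scalarCurv_leftFrame (hb : IsStandardBasis α β b) (x : G) :
    scalarCurv (leftMetric b) (leftConn α β b) (leftFrame b) x = ∑ p, ricciEigenvalue α β p := by
  simp [scalarCurv, ricci_leftFrame hb]

lemma bach_leftFrame (hb : IsStandardBasis α β b) (h₁ : α * β = -1 / 8)
    (h₂ : α ^ 2 + β ^ 2 = 7 / 8) (i j : Fin 4) (x : G) :
    bach (leftMetric b) (leftConn α β b) (leftFrame b) i j x = 0 := by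
  have hH (p q r s : Fin 4) : hessRicci (leftMetric b) (leftConn α β b) (leftFrame b)
      (leftFrame b p) (leftFrame b q) (leftFrame b r) (leftFrame b s) x =
      hessRicciCoord α β (Pi.single p 1) (Pi.single q 1) (Pi.single r 1) (Pi.single s 1) := by
    rw [← hessRicci_leftField hb _ _ _ _ x]
    simp only [← leftFrame_eq_leftField]
  simp only [bach, hH, ricci_leftFrame hb, scalarCurv_leftFrame hb]
  refine Eq.trans ?_ (bachCoord_eq_zero h₁ h₂ i j)
  rw [bachCoord]
  rcases eq_or_ne i j with rfl | h
  · simp [pow_two]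
  · simp [h, h.symm]

lemma riemann_leftFrame (hb : IsStandardBasis α β b) (i j k l : Fin 4) (x : G) :
    riemann (leftMetric b) (leftConn α β b) (leftFrame b) i j k l x =
      curvCoord α β (Pi.single i 1) (Pi.single j 1) (Pi.single l 1) k := by
  simp only [riemann, leftFrame_eq_leftField, curvature_leftConn_leftField hb,
    leftMetric_leftField]
  simp [Pi.single_apply]

lemma leviCivitaSymbol_zero_two (p q : Fin 4) :
    leviCivitaSymbol 0 2 p q =
      if p = 1 ∧ q = 3 then -1 else if p = 3 ∧ q = 1 then 1 else 0 := by
  -- Over `ℤ` the determinants are decidable; the values are then transported to `ℝ`.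
  have h (p q : Fin 4) : Matrix.det (Matrix.of fun a b : Fin 4 =>
      if ![(0 : Fin 4), 2, p, q] a = b then (1 : ℤ) else 0) =
      if p = 1 ∧ q = 3 then -1 else if p = 3 ∧ q = 1 then 1 else 0 := by
    revert p q
    decide +kernel
  have h2 := (Int.castRingHom ℝ).map_det (Matrix.of fun a b : Fin 4 =>
      if ![(0 : Fin 4), 2, p, q] a = b then (1 : ℤ) else 0)
  rw [h] at h2
  have h3 : (Int.castRingHom ℝ).mapMatrix (Matrix.of fun a b : Fin 4 =>
      if ![(0 : Fin 4), 2, p, q] a = b then (1 : ℤ) else 0) =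
      Matrix.of fun a b : Fin 4 => kron (![0, 2, p, q] a) b := by
    ext a b
    simp [kron]
  rw [leviCivitaSymbol, ← h3, ← h2]
  simp

lemma weylHalf_leftFrame (hb : IsStandardBasis α β b) (h₁ : α * β = -1 / 8)
    (h₂ : α ^ 2 + β ^ 2 = 7 / 8) (s : ℝ) (x : G) :
    weylHalf s (leftMetric b) (leftConn α β b) (leftFrame b) 0 2 0 2 x =
      1 / 2 * (1 / 8 + s * (β / 2)) := by
  have e : ∑ p, ∑ q, leviCivitaSymbol 0 2 p q *
      weyl (leftMetric b) (leftConn α β b) (leftFrame b) 0 2 p q x =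
      weyl (leftMetric b) (leftConn α β b) (leftFrame b) 0 2 3 1 x -
      weyl (leftMetric b) (leftConn α β b) (leftFrame b) 0 2 1 3 x := by
    simp [leviCivitaSymbol_zero_two, Fin.sum_univ_four]
    ring
  rw [weylHalf, e]
  simp only [weyl, riemann_leftFrame hb, ricci_leftFrame hb, scalarCurv_leftFrame hb]
  simp [curvCoord, connCoord, lieCoord, ricciEigenvalue, kron, Fin.sum_univ_four]
  grind

end LieGroup

/-! ### Curvature in a frame with non-constant connection coefficients. -/

section Manifold

variable {M : Type*} [TopologicalSpace M] [ChartedSpace E4 M] [IsManifold (𝓡 4) ∞ M]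

lemma DiffFieldAt.sum_smul {ι : Type*} {s : Finset ι} {f : ι → M → ℝ} {X : ι → VField M} {x : M}
    (hf : ∀ i, MDifferentiableAt (𝓡 4) 𝓘(ℝ, ℝ) (f i) x) (hX : ∀ i, DiffFieldAt (X i) x) :
    DiffFieldAt (∑ i ∈ s, f i • X i) x := by
  classical
  induction s using Finset.induction_on with
  | empty => exact mdifferentiableAt_zeroSection ..
  | insert a s ha ih =>
    rw [Finset.sum_insert ha]
    exact mdifferentiableAt_add_section (MDifferentiableAt.smul_section (hf a) (hX a)) ih

lemma covariantDerivative_sum_smul {cov : ConnOp M} {U : Set M}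
    (hcov : IsCovariantDerivativeOn E4 cov U) {ι : Type*} {s : Finset ι} {f : ι → M → ℝ}
    {X : ι → VField M} {x : M} (hx : x ∈ U)
    (hf : ∀ i, MDifferentiableAt (𝓡 4) 𝓘(ℝ, ℝ) (f i) x) (hX : ∀ i, DiffFieldAt (X i) x)
    (v : TangentSpace (𝓡 4) x) :
    cov (∑ i ∈ s, f i • X i) x v =
      ∑ i ∈ s, (f i x • cov (X i) x v + mvfderiv (𝓡 4) (f i) x v • X i x) := by
  classical
  induction s using Finset.induction_on with
  | empty => simp [hcov.zero hx]
  | insert a s ha ih =>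
    rw [Finset.sum_insert ha, Finset.sum_insert ha,
      hcov.add (MDifferentiableAt.smul_section (hf a) (hX a)) (DiffFieldAt.sum_smul hf hX) hx,
      hcov.leibniz (hX a) (hf a) hx, add_apply, ih]
    rfl

/-- Components of the curvature in terms of the connection coefficients of an orthonormal frame. -/
lemma curvature_eq_of_connection_coeff {g : BilinField M} {cov : ConnOp M} {U : Set M}
    (hU : IsOpen U) (hcov : IsCovariantDerivativeOn E4 cov U) {e : Fin 4 → VField M}
    (he : ∀ x ∈ U, ∀ i, DiffFieldAt (e i) x)
    {Γ : Fin 4 → Fin 4 → Fin 4 → M → ℝ}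
    (hΓ : ∀ x ∈ U, ∀ i j k, MDifferentiableAt (𝓡 4) 𝓘(ℝ, ℝ) (Γ i j k) x)
    (hcΓ : ∀ x ∈ U, ∀ i j, cov (e j) x (e i x) = ∑ k, Γ i j k x • e k x)
    {x : M} (hx : x ∈ U) (hg : ∀ i j, g x (e i x) (e j x) = if i = j then 1 else 0)
    {C : Fin 4 → Fin 4 → Fin 4 → ℝ}
    (hC : ∀ i j, mlieBracket (𝓡 4) (e i) (e j) x = ∑ k, C i j k • e k x) (i j k l : Fin 4) :
    g x (curvature cov (e i) (e j) (e k) x) (e l x) =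
      mvfderiv (𝓡 4) (Γ j k l) x (e i x) - mvfderiv (𝓡 4) (Γ i k l) x (e j x) +
      ∑ m, (Γ j k m x * Γ i m l x - Γ i k m x * Γ j m l x - C i j m * Γ m k l x) := by
  have h1 (i j k : Fin 4) : nabla cov (e i) (nabla cov (e j) (e k)) x =
      ∑ m, (Γ j k m x • (∑ l, Γ i m l x • e l x) +
        mvfderiv (𝓡 4) (Γ j k m) x (e i x) • e m x) := by
    have hd : DiffFieldAt (∑ m, Γ j k m • e m) x :=
      DiffFieldAt.sum_smul (hΓ x hx j k) (he x hx)
    -- The second covariant derivative needs the frame expansion of the first one near `x`, not only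
    -- at `x`.
    have hev : ∀ᶠ y in nhds x, nabla cov (e j) (e k) y = (∑ m, Γ j k m • e m) y := by
      filter_upwards [hU.mem_nhds hx] with y hy
      rw [nabla, hcΓ y hy]
      simp
    have hd' : DiffFieldAt (nabla cov (e j) (e k)) x :=
      MDifferentiableAt.congr_of_eventuallyEq hd
        (hev.mono fun y hy => congrArg (TotalSpace.mk' E4 y) hy)
    rw [nabla, hcov.congr_of_eventuallyEq hd' hd (hU.mem_nhds hx) hev,
      covariantDerivative_sum_smul hcov hx (hΓ x hx j k) (he x hx)]
    simp only [hcΓ x hx]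
  have h2 : nabla cov (mlieBracket (𝓡 4) (e i) (e j)) (e k) x =
      ∑ m, C i j m • ∑ l, Γ m k l x • e l x := by
    rw [nabla, hC, map_sum]
    simp only [map_smul, hcΓ x hx]
  have h3 (v : Fin 4 → ℝ) : g x (∑ m, v m • e m x) (e l x) = v l := by
    rw [map_sum, sum_apply]
    simp [hg]
  have h4 (v w : TangentSpace (𝓡 4) x) : g x (v - w) (e l x) = g x v (e l x) - g x w (e l x) := by
    rw [map_sub, sub_apply]
  have h5 (v w : TangentSpace (𝓡 4) x) : g x (v + w) (e l x) = g x v (e l x) + g x w (e l x) := by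
    rw [map_add, add_apply]
  have h6 (a : Fin 4 → ℝ) (B : Fin 4 → Fin 4 → ℝ) :
      g x (∑ m, a m • ∑ l, B m l • e l x) (e l x) = ∑ m, a m * B m l := by
    rw [map_sum, sum_apply]
    refine Finset.sum_congr rfl fun m _ => ?_
    rw [map_smul, smul_apply, h3, smul_eq_mul]
  rw [curvature, Pi.sub_apply, Pi.sub_apply, h1, h1, h2, Finset.sum_add_distrib,
    Finset.sum_add_distrib, h4, h4, h5, h5, h6, h6, h6, h3, h3, Finset.sum_sub_distrib,
    Finset.sum_sub_distrib]
  ring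

end Manifold

/-- Connection coefficients in an orthonormal frame are determined by their torsion. -/
lemma eq_of_sub_swap_eq {Γ Γ' : Fin 4 → Fin 4 → Fin 4 → ℝ}
    (ht : ∀ i j k, Γ i j k - Γ j i k = Γ' i j k - Γ' j i k)
    (hm : ∀ i j k, Γ i j k + Γ i k j = 0) (hm' : ∀ i j k, Γ' i j k + Γ' i k j = 0)
    (i j k : Fin 4) : Γ i j k = Γ' i j k := by
  -- As in the Koszul formula: the difference of `Γ` and `Γ'` is symmetric in the first two indices
  -- and skew in the last two, hence zero.
  linarith [ht i j k, ht j k i, ht k i j, hm i j k, hm j k i, hm k i j, hm' i j k, hm' j k i,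
    hm' k i j, hm j i k, hm' j i k]

/-! ### Algebra of the conformal Einstein equation. -/

section Coordinates

/-- Connection coefficients of `u⁻² h` in the frame `u eᵢ`, where `d i` is the derivative of `u`
along `eᵢ`. -/
noncomputable def confCoeff (α β u : ℝ) (d : Fin 4 → ℝ) (i j k : Fin 4) : ℝ :=
  u * connCoord α β (Pi.single i 1) (Pi.single j 1) k - d j * kron i k + d k * kron i j

/-- Structure functions of the frame `u eᵢ`. -/
noncomputable def confStruct (α β u : ℝ) (d : Fin 4 → ℝ) (i j k : Fin 4) : ℝ :=
  u * lieCoord α β (Pi.single i 1) (Pi.single j 1) k + d i * kron j k - d j * kron i k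

/-- Derivatives of `confCoeff` along `u eₚ`, where `H p i` is the derivative of `d i` along `eₚ`. -/
noncomputable def confCoeffDeriv (α β u : ℝ) (d : Fin 4 → ℝ) (H : Fin 4 → Fin 4 → ℝ)
    (p i j k : Fin 4) : ℝ :=
  u * (d p * connCoord α β (Pi.single i 1) (Pi.single j 1) k - H p j * kron i k + H p k * kron i j)

/-- The covariant Hessian of `u`. -/
noncomputable def hessCoord (α β : ℝ) (d : Fin 4 → ℝ) (H : Fin 4 → Fin 4 → ℝ) (i j : Fin 4) : ℝ :=
  H i j - ∑ m, connCoord α β (Pi.single i 1) (Pi.single j 1) m * d m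

lemma confCoeff_sub_swap (α β u : ℝ) (d : Fin 4 → ℝ) (i j k : Fin 4) :
    confCoeff α β u d i j k - confCoeff α β u d j i k = confStruct α β u d i j k := by
  have h := congrFun (connCoord_sub_connCoord α β (Pi.single i 1) (Pi.single j 1)) k
  rw [Pi.sub_apply] at h
  rw [confCoeff, confCoeff, confStruct, ← h, show kron j i = kron i j by simp [kron, eq_comm]]
  ring

lemma confCoeff_add_swap (α β u : ℝ) (d : Fin 4 → ℝ) (i j k : Fin 4) :
    confCoeff α β u d i j k + confCoeff α β u d i k j = 0 := by
  have h := sum_connCoord_mul α β (Pi.single i 1) (Pi.single j 1) (Pi.single k 1)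
  simp only [Finset.sum_add_distrib, Pi.single_apply, mul_ite, mul_one, mul_zero, ite_mul,
    one_mul, zero_mul, Finset.sum_ite_eq', Finset.mem_univ, if_true] at h
  rw [confCoeff, confCoeff]
  linear_combination u * h

-- This is Ric(u⁻²h) = ρ + 2u⁻¹ Hess u + (u⁻¹Δu - 3u⁻²|du|²) h evaluated on the frame u e_i. It is a
-- formal identity in `u`, `d` and `H`; no commutation relation for `H` is needed.
set_option maxHeartbeats 4000000 in
lemma conformal_ricci (α β u : ℝ) (d : Fin 4 → ℝ) (H : Fin 4 → Fin 4 → ℝ) (j k : Fin 4) :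
    ∑ p, (confCoeffDeriv α β u d H p j k p - confCoeffDeriv α β u d H j p k p +
      ∑ m, (confCoeff α β u d j k m * confCoeff α β u d p m p -
        confCoeff α β u d p k m * confCoeff α β u d j m p -
        confStruct α β u d p j m * confCoeff α β u d m k p)) =
    2 * u * hessCoord α β d H j k + u ^ 2 * ricciEigenvalue α β j * kron j k +
      (u * ∑ m, hessCoord α β d H m m - 3 * ∑ m, d m ^ 2) * kron j k := by
  simp only [confCoeffDeriv, confCoeff, confStruct, hessCoord, Fin.sum_univ_four]
  fin_cases j <;> fin_cases k <;>
    simp [connCoord, lieCoord, kron, ricciEigenvalue] <;> ring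

/-- The right hand side of the conformal Einstein equation `Hess u = -u ρ / 2 + l h`, solved for the
second derivatives of `u`. -/
noncomputable def solvedHess (α β u l : ℝ) (d : Fin 4 → ℝ) (i j : Fin 4) : ℝ :=
  ∑ m, connCoord α β (Pi.single i 1) (Pi.single j 1) m * d m -
    1 / 2 * (ricciEigenvalue α β i * kron i j) * u + kron i j * l

/-- First derivatives of `solvedHess`. -/
noncomputable def solvedHessDeriv (α β u l : ℝ) (d l' : Fin 4 → ℝ) (p i j : Fin 4) : ℝ :=
  ∑ m, connCoord α β (Pi.single i 1) (Pi.single j 1) m * solvedHess α β u l d p m -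
    1 / 2 * (ricciEigenvalue α β i * kron i j) * d p + kron i j * l' p

/-- Integrability of the conformal Einstein equation. -/
lemma eq_zero_of_integrability {α β u l : ℝ} {d l' : Fin 4 → ℝ}
    (h₁ : α * β = -1 / 8) (h₂ : α ^ 2 + β ^ 2 = 7 / 8)
    (h : ∀ i j k, solvedHessDeriv α β u l d l' i j k - solvedHessDeriv α β u l d l' j i k =
      ∑ m, lieCoord α β (Pi.single i 1) (Pi.single j 1) m * solvedHess α β u l d m k) :
    d 1 = 0 ∧ d 2 = 0 ∧ d 3 = 0 := by
  -- Each consecutive pair shares one unknown `l' j`, for j = 1, 2, 3. Eliminating it leaves `d j`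
  -- times a difference of two Weyl components W_{ijij}, namely ±3/8.
  have ha := h 0 1 0
  have hb := h 2 1 2
  have hc := h 0 2 0
  have hd := h 1 2 1
  have he := h 0 3 0
  have hf := h 1 3 1
  simp [solvedHessDeriv, solvedHess, lieCoord, connCoord, kron, Fin.sum_univ_four,
    ricciEigenvalue] at ha hb hc hd he hf
  refine ⟨?_, ?_, ?_⟩
  · grind
  · grind
  · grind

/-- Contradiction from the diagonal conformal Einstein equations for `u` depending on the first
direction only. -/
lemma solvedHess_diag_false {α β u l : ℝ} {d : Fin 4 → ℝ} (hu : u ≠ 0)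
    (h₁ : α * β = -1 / 8) (h₂ : α ^ 2 + β ^ 2 = 7 / 8) (hd : d 1 = 0 ∧ d 2 = 0 ∧ d 3 = 0)
    (h : ∀ i, i ≠ 0 → solvedHess α β u l d i i = 0) : False := by
  have ha := h 1 (by simp)
  have hb := h 2 (by simp)
  have hc := h 3 (by simp)
  obtain ⟨hd1, hd2, hd3⟩ := hd
  simp [solvedHess, connCoord, kron, Fin.sum_univ_four, ricciEigenvalue, hd1, hd2, hd3] at ha hb hc
  have hne : β - α ≠ 0 := fun h0 => by
    rw [sub_eq_zero.1 h0] at h₁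
    nlinarith [sq_nonneg α]
  -- Eliminating `l` and `d 0` from the three equations leaves (β - α)(1/2 - 2(α² + αβ + β²)) u = 0,
  -- where the middle factor is -1.
  refine (mul_ne_zero hne hu) ?_
  grind

end Coordinates

/-! ### Derivatives of functions along the left-invariant frame. -/

section Manifold

variable {M : Type*} [TopologicalSpace M] [ChartedSpace E4 M] {f g : M → ℝ} {x : M}

lemma mdifferentiableAt_const_mul (hf : MDifferentiableAt (𝓡 4) 𝓘(ℝ, ℝ) f x) (c : ℝ) :
    MDifferentiableAt (𝓡 4) 𝓘(ℝ, ℝ) (fun y => c * f y) x :=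
  mdifferentiableAt_const.mul hf

lemma mdifferentiableAt_fun_add (hf : MDifferentiableAt (𝓡 4) 𝓘(ℝ, ℝ) f x)
    (hg : MDifferentiableAt (𝓡 4) 𝓘(ℝ, ℝ) g x) :
    MDifferentiableAt (𝓡 4) 𝓘(ℝ, ℝ) (fun y => f y + g y) x :=
  hf.add hg

lemma mvfderiv_eq_zero_of_eventuallyEq_const {c : ℝ} (h : f =ᶠ[nhds x] fun _ => c) :
    mvfderiv (𝓡 4) f x = 0 := by
  have : mvfderiv (𝓡 4) f x = mvfderiv (𝓡 4) (fun _ : M => c) x := by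
    rw [mvfderiv, mvfderiv, h.mfderiv_eq, h.eq_of_nhds]
  rw [this, mvfderiv_const]

end Manifold

section LieGroup

variable {G : Type*} [TopologicalSpace G] [ChartedSpace E4 G] [Group G]

/-- The derivative of a function along a left-invariant frame field. -/
noncomputable def frameDeriv (b : Module.Basis (Fin 4) ℝ (GroupLieAlgebra (𝓡 4) G)) (i : Fin 4)
    (u : G → ℝ) (x : G) : ℝ :=
  mvfderiv (𝓡 4) u x (leftFrame b i x)

variable {α β : ℝ} {b : Module.Basis (Fin 4) ℝ (GroupLieAlgebra (𝓡 4) G)}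

lemma frameDeriv_congr {u v : G → ℝ} {x : G} (h : u =ᶠ[nhds x] v) (i : Fin 4) :
    frameDeriv b i u x = frameDeriv b i v x := by
  rw [frameDeriv, frameDeriv, mvfderiv, mvfderiv, h.mfderiv_eq, h.eq_of_nhds]

lemma frameDeriv_add {u v : G → ℝ} {x : G} (hu : MDifferentiableAt (𝓡 4) 𝓘(ℝ, ℝ) u x)
    (hv : MDifferentiableAt (𝓡 4) 𝓘(ℝ, ℝ) v x) (i : Fin 4) :
    frameDeriv b i (fun y => u y + v y) x = frameDeriv b i u x + frameDeriv b i v x := by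
  rw [frameDeriv, mvfderiv_fun_add hu hv, add_apply, frameDeriv, frameDeriv]

lemma frameDeriv_const_mul {u : G → ℝ} {x : G} (hu : MDifferentiableAt (𝓡 4) 𝓘(ℝ, ℝ) u x)
    (c : ℝ) (i : Fin 4) : frameDeriv b i (fun y => c * u y) x = c * frameDeriv b i u x := by
  rw [frameDeriv, mvfderiv_fun_mul mdifferentiableAt_const hu, mvfderiv_const]
  simp [frameDeriv]

lemma frameDeriv_sum {ι : Type*} {s : Finset ι} {f : ι → G → ℝ} {x : G}
    (hf : ∀ m ∈ s, MDifferentiableAt (𝓡 4) 𝓘(ℝ, ℝ) (f m) x) (i : Fin 4) :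
    frameDeriv b i (fun y => ∑ m ∈ s, f m y) x = ∑ m ∈ s, frameDeriv b i (f m) x := by
  rw [frameDeriv, mvfderiv_fun_sum hf, sum_apply]
  rfl

variable [LieGroup (𝓡 4) ∞ G]

lemma contMDiffAt_frameDeriv {u : G → ℝ} {x : G} (hu : ContMDiffAt (𝓡 4) 𝓘(ℝ, ℝ) ∞ u x)
    (i : Fin 4) : ContMDiffAt (𝓡 4) 𝓘(ℝ, ℝ) ∞ (frameDeriv b i u) x :=
  contMDiffAt_mvfderiv_apply hu (smoothFieldAt_leftFrame b i x)

lemma mlieBracket_leftFrame (hb : IsStandardBasis α β b) (i j : Fin 4) (x : G) :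
    mlieBracket (𝓡 4) (leftFrame b i) (leftFrame b j) x =
      ∑ k, lieCoord α β (Pi.single i 1) (Pi.single j 1) k • leftFrame b k x := by
  rw [leftFrame_eq_leftField b i, leftFrame_eq_leftField b j, mlieBracket_leftField hb,
    leftField_apply]

lemma frameDeriv_comm (hb : IsStandardBasis α β b) {u : G → ℝ} {x : G}
    (hu : ContMDiffAt (𝓡 4) 𝓘(ℝ, ℝ) ∞ u x) (i j : Fin 4) :
    frameDeriv b i (frameDeriv b j u) x - frameDeriv b j (frameDeriv b i u) x =
      ∑ k, lieCoord α β (Pi.single i 1) (Pi.single j 1) k * frameDeriv b k u x := by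
  -- Any field non-zero at `x` serves as the auxiliary field in `mvfderiv_mlieBracket`.
  have hne : leftFrame b 0 x ≠ 0 := fun h => by
    have := leftCoframe_leftFrame b 0 0 x
    rw [h, map_zero] at this
    simp at this
  have h := mvfderiv_mlieBracket hu (smoothFieldAt_leftFrame b i x)
    (smoothFieldAt_leftFrame b j x) (smoothFieldAt_leftFrame b 0 x) hne
  rw [mlieBracket_leftFrame hb, map_sum] at h
  simp only [map_smul, smul_eq_mul] at h
  exact h.symm

lemma mlieBracket_smul_leftFrame (hb : IsStandardBasis α β b) {u : G → ℝ} {x : G}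
    (hu : MDifferentiableAt (𝓡 4) 𝓘(ℝ, ℝ) u x) (i j : Fin 4) :
    mlieBracket (𝓡 4) (u • leftFrame b i) (u • leftFrame b j) x =
      ∑ k, confStruct α β (u x) (fun i => frameDeriv b i u x) i j k • (u • leftFrame b k) x := by
  have hi := (smoothFieldAt_leftFrame b i x).diffFieldAt
  have hj := (smoothFieldAt_leftFrame b j x).diffFieldAt
  rw [mlieBracket_smul_left hu hi, mlieBracket_smul_right hu hj, mlieBracket_leftFrame hb]
  have hm : mvfderiv (𝓡 4) u x ((u • leftFrame b j) x) = u x * frameDeriv b j u x :=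
    map_smul (mvfderiv (𝓡 4) u x) (u x) (leftFrame b j x)
  rw [hm]
  refine eq_of_leftCoframe_eq b fun l => ?_
  change leftCoframe b l x (-(u x * frameDeriv b j u x) • leftFrame b i x +
      u x • (frameDeriv b i u x • leftFrame b j x +
        u x • ∑ k, lieCoord α β (Pi.single i 1) (Pi.single j 1) k • leftFrame b k x)) =
    leftCoframe b l x (∑ k, confStruct α β (u x) (fun i => frameDeriv b i u x) i j k •
      (u x • leftFrame b k x))
  simp only [map_add, map_smul, map_sum, leftCoframe_leftFrame, smul_eq_mul, mul_ite, mul_one,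
    mul_zero, Finset.sum_ite_eq, Finset.mem_univ, if_true, confStruct, kron]
  simp only [eq_comm (a := l)]
  split_ifs <;> ring

/-! ### The conformal Einstein equation on the group. -/

section ConnectionCoefficients

variable {u : G → ℝ} {x : G} (hu : ContMDiffAt (𝓡 4) 𝓘(ℝ, ℝ) ∞ u x)
include hu

lemma mdifferentiableAt_confCoeff (i j k : Fin 4) : MDifferentiableAt (𝓡 4) 𝓘(ℝ, ℝ)
    (fun y => confCoeff α β (u y) (fun m => frameDeriv b m u y) i j k) x := by
  have h (m) : MDifferentiableAt (𝓡 4) 𝓘(ℝ, ℝ) (frameDeriv b m u) x :=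
    (contMDiffAt_frameDeriv hu m).mdifferentiableAt (by simp)
  exact (((hu.mdifferentiableAt (by simp)).mul mdifferentiableAt_const).sub
    ((h j).mul mdifferentiableAt_const)).add ((h k).mul mdifferentiableAt_const)

lemma frameDeriv_confCoeff (p i j k : Fin 4) :
    u x * frameDeriv b p
      (fun y => confCoeff α β (u y) (fun m => frameDeriv b m u y) i j k) x =
    confCoeffDeriv α β (u x) (fun m => frameDeriv b m u x)
      (fun p m => frameDeriv b p (frameDeriv b m u) x) p i j k := by
  have h (m) : MDifferentiableAt (𝓡 4) 𝓘(ℝ, ℝ) (frameDeriv b m u) x :=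
    (contMDiffAt_frameDeriv hu m).mdifferentiableAt (by simp)
  have hu' : MDifferentiableAt (𝓡 4) 𝓘(ℝ, ℝ) u x := hu.mdifferentiableAt (by simp)
  have e : (fun y => confCoeff α β (u y) (fun m => frameDeriv b m u y) i j k) = fun y =>
      (connCoord α β (Pi.single i 1) (Pi.single j 1) k * u y +
        -kron i k * frameDeriv b j u y) + kron i j * frameDeriv b k u y := by
    funext y
    rw [confCoeff]
    ring
  rw [e, frameDeriv_add (mdifferentiableAt_fun_add
        (mdifferentiableAt_const_mul hu' _) (mdifferentiableAt_const_mul (h j) _))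
      (mdifferentiableAt_const_mul (h k) _),
    frameDeriv_add (mdifferentiableAt_const_mul hu' _) (mdifferentiableAt_const_mul (h j) _),
    frameDeriv_const_mul hu', frameDeriv_const_mul (h j), frameDeriv_const_mul (h k),
    confCoeffDeriv]
  ring

/-- The second derivatives of `u` that appear are replaced through the equation itself. The system
closes up in `u`, its first derivatives, `l` and the first derivatives of `l`. -/
lemma frameDeriv_solvedHess {l : G → ℝ} (hl : MDifferentiableAt (𝓡 4) 𝓘(ℝ, ℝ) l x)
    (h : ∀ i j, frameDeriv b i (frameDeriv b j u) x =
      solvedHess α β (u x) (l x) (fun m => frameDeriv b m u x) i j) (p i j : Fin 4) :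
    frameDeriv b p
      (fun y => solvedHess α β (u y) (l y) (fun m => frameDeriv b m u y) i j) x =
    solvedHessDeriv α β (u x) (l x) (fun m => frameDeriv b m u x)
      (fun m => frameDeriv b m l x) p i j := by
  have hd (m) : MDifferentiableAt (𝓡 4) 𝓘(ℝ, ℝ) (frameDeriv b m u) x :=
    (contMDiffAt_frameDeriv hu m).mdifferentiableAt (by simp)
  have hu' : MDifferentiableAt (𝓡 4) 𝓘(ℝ, ℝ) u x := hu.mdifferentiableAt (by simp)
  have hs : ∀ m ∈ Finset.univ, MDifferentiableAt (𝓡 4) 𝓘(ℝ, ℝ) (fun y =>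
      connCoord α β (Pi.single i 1) (Pi.single j 1) m * frameDeriv b m u y) x :=
    fun m _ => mdifferentiableAt_const_mul (hd m) _
  have e : (fun y => solvedHess α β (u y) (l y) (fun m => frameDeriv b m u y) i j) = fun y =>
      (∑ m, connCoord α β (Pi.single i 1) (Pi.single j 1) m * frameDeriv b m u y +
        -(1 / 2 * (ricciEigenvalue α β i * kron i j)) * u y) + kron i j * l y := by
    funext y
    rw [solvedHess]
    ring
  rw [e, frameDeriv_add (mdifferentiableAt_fun_add
        (mdifferentiableAt_fun_sum hs) (mdifferentiableAt_const_mul hu' _))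
      (mdifferentiableAt_const_mul hl _),
    frameDeriv_add (mdifferentiableAt_fun_sum hs) (mdifferentiableAt_const_mul hu' _),
    frameDeriv_const_mul hu', frameDeriv_const_mul hl, frameDeriv_sum hs, solvedHessDeriv]
  simp only [frameDeriv_const_mul (hd _), h]
  ring

end ConnectionCoefficients

/-- Data of an Einstein metric `f h` conformal to the left-invariant metric `h`, in terms of
`u = f ^ (-1/2)`. -/
lemma exists_conformal_factor_equation (hb : IsStandardBasis α β b) {U : Set G} (hU : IsOpen U)
    {f : G → ℝ} (hf : ContMDiffOn (𝓡 4) 𝓘(ℝ, ℝ) ∞ f U) (hpos : ∀ y ∈ U, 0 < f y)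
    (hE : IsEinsteinOn (fun y => f y • leftMetric b y) U) :
    ∃ u : G → ℝ, (∀ y ∈ U, u y ≠ 0) ∧ (∀ y ∈ U, ContMDiffAt (𝓡 4) 𝓘(ℝ, ℝ) ∞ u y) ∧
      ∃ l : G → ℝ, ∀ y ∈ U, MDifferentiableAt (𝓡 4) 𝓘(ℝ, ℝ) l y ∧ ∀ i j, frameDeriv b i (frameDeriv b j u) y =
        solvedHess α β (u y) (l y) (fun i => frameDeriv b i u y) i j := by
  obtain ⟨cov, hcov, c, hc⟩ := hE
  set g : BilinField G := fun y => f y • leftMetric b y with hg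
  let u : G → ℝ := fun y => (√(f y))⁻¹
  have hu0 (y) (hy : y ∈ U) : u y ≠ 0 := inv_ne_zero (Real.sqrt_ne_zero'.2 (hpos y hy))
  have hfu (y) (hy : y ∈ U) : f y * u y ^ 2 = 1 := by
    simp only [u, inv_pow, Real.sq_sqrt (hpos y hy).le]
    exact mul_inv_cancel₀ (hpos y hy).ne'
  have hu (y) (hy : y ∈ U) : ContMDiffAt (𝓡 4) 𝓘(ℝ, ℝ) ∞ u y := by
    have h1 : ContDiffAt ℝ ∞ (fun t : ℝ => (√t)⁻¹) (f y) :=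
      (Real.contDiffAt_sqrt (hpos y hy).ne').inv (Real.sqrt_ne_zero'.2 (hpos y hy))
    exact h1.contMDiffAt.comp y (hf.contMDiffAt (hU.mem_nhds hy))
  have hud (y) (hy : y ∈ U) := (hu y hy).mdifferentiableAt (by simp)
  let e : Fin 4 → VField G := fun i => u • leftFrame b i
  have hes (y) (hy : y ∈ U) (i) : SmoothFieldAt (e i) y :=
    (smoothFieldAt_leftFrame b i y).smul (hu y hy)
  have hgl (y : G) (v w : TangentSpace (𝓡 4) y) : g y v w = f y * leftMetric b y v w := rfl
  have hge (y) (v : TangentSpace (𝓡 4) y) (i) : g y v (e i y) = f y * u y * leftCoframe b i y v := by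
    rw [hgl, leftMetric_apply]
    simp [e, leftCoframe_leftFrame]
    ring
  have hgo (y) (hy : y ∈ U) (i j) : g y (e i y) (e j y) = if i = j then 1 else 0 := by
    rw [hge]
    change f y * u y * leftCoframe b j y (u y • leftFrame b i y) = _
    rw [map_smul, leftCoframe_leftFrame, smul_eq_mul]
    simp only [eq_comm (a := j)]
    split_ifs
    · linear_combination hfu y hy
    · ring
  have hgs (y) (v w : TangentSpace (𝓡 4) y) : g y v w = g y w v := by
    rw [hgl, hgl, leftMetric_apply, leftMetric_apply]
    simp only [mul_comm]
  have hexp (y) (hy : y ∈ U) (v : TangentSpace (𝓡 4) y) : v = ∑ k, g y v (e k y) • e k y := by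
    conv_lhs => rw [← sum_leftCoframe_smul_leftFrame b y v]
    refine Finset.sum_congr rfl fun k _ => ?_
    rw [hge]
    change _ = _ • (u y • leftFrame b k y)
    rw [smul_smul]
    congr 1
    linear_combination -leftCoframe b k y v * hfu y hy
  have hC (y) (hy : y ∈ U) (i j) : mlieBracket (𝓡 4) (e i) (e j) y =
      ∑ k, confStruct α β (u y) (fun i => frameDeriv b i u y) i j k • e k y :=
    mlieBracket_smul_leftFrame hb (hud y hy) i j
  have hΓ (y) (hy : y ∈ U) (i j) : cov (e j) y (e i y) =
      ∑ k, confCoeff α β (u y) (fun i => frameDeriv b i u y) i j k • e k y := by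
    -- The unknown connection is torsion free and metric, so in the orthonormal frame `e` its
    -- coefficients must be `confCoeff`.
    have key := eq_of_sub_swap_eq
      (Γ := fun i j k => g y (cov (e j) y (e i y)) (e k y))
      (Γ' := confCoeff α β (u y) (fun i => frameDeriv b i u y)) (fun i j k => ?_)
      (fun i j k => ?_) (confCoeff_add_swap α β (u y) _)
    · conv_lhs => rw [hexp y hy (cov (e j) y (e i y))]
      simp only [key]
    · rw [confCoeff_sub_swap, ← sub_apply, ← map_sub,
        hcov.torsion_free y hy _ _ (hes y hy i).diffFieldAt (hes y hy j).diffFieldAt, hC y hy,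
        map_sum, sum_apply]
      simp [hgo y hy]
    · have h := hcov.metric y hy _ _ (hes y hy j).diffFieldAt (hes y hy k).diffFieldAt (e i y)
      have hev : (fun z => g z (e j z) (e k z)) =ᶠ[nhds y] fun _ => if j = k then 1 else 0 := by
        filter_upwards [hU.mem_nhds hy] with z hz using hgo z hz j k
      rw [mvfderiv_eq_zero_of_eventuallyEq_const hev, zero_apply] at h
      rw [hgs y (cov (e k) y (e i y)), h]
  have hR (y) (hy : y ∈ U) (j k) : 2 * u y * hessCoord α β (fun i => frameDeriv b i u y)
        (fun p i => frameDeriv b p (frameDeriv b i u) y) j k +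
      u y ^ 2 * ricciEigenvalue α β j * kron j k +
      (u y * ∑ m, hessCoord α β (fun i => frameDeriv b i u y)
        (fun p i => frameDeriv b p (frameDeriv b i u) y) m m -
        3 * ∑ m, frameDeriv b m u y ^ 2) * kron j k = c * kron j k := by
    have h := hc U hU subset_rfl e
      ⟨fun i z hz => (hes z hz i).contMDiffWithinAt, fun z hz => hgo z hz⟩ y hy j k
    rw [hgo y hy] at h
    rw [kron, ← h, ricci, ← kron, ← conformal_ricci]
    refine Finset.sum_congr rfl fun p _ => ?_
    have hmv (i j k p) : mvfderiv (𝓡 4) (fun y => confCoeff α β (u y)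
        (fun i => frameDeriv b i u y) i j k) y (e p y) =
        confCoeffDeriv α β (u y) (fun m => frameDeriv b m u y)
          (fun p m => frameDeriv b p (frameDeriv b m u) y) p i j k := by
      rw [← frameDeriv_confCoeff (hu y hy)]
      change mvfderiv (𝓡 4) _ y (u y • leftFrame b p y) = _
      rw [map_smul, smul_eq_mul, frameDeriv]
    rw [curvature_eq_of_connection_coeff hU hcov.isCovariantDerivativeOn
      (fun z hz i => (hes z hz i).diffFieldAt)
      (fun z hz i j k => mdifferentiableAt_confCoeff (hu z hz) i j k) hΓ hy (hgo y hy) (hC y hy),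
      hmv, hmv]
  -- `l` is read off from the (0,0) equation, where ∇_{e_0} e_0 = 0 makes the Hessian a plain second
  -- derivative. Thus `l` is differentiable.
  refine ⟨u, hu0, hu, fun y => 1 / 2 * ricciEigenvalue α β 0 * u y +
    frameDeriv b 0 (frameDeriv b 0 u) y, fun y hy => ⟨?_, fun i j => ?_⟩⟩
  · exact (mdifferentiableAt_const_mul (hud y hy) _).add
      ((contMDiffAt_frameDeriv (contMDiffAt_frameDeriv (hu y hy) 0) 0).mdifferentiableAt (by simp))
  · have h0 := hR y hy 0 0
    have h := hR y hy i j
    have hc0 : ∑ m, connCoord α β (Pi.single 0 1) (Pi.single 0 1) m * frameDeriv b m u y = 0 := by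
      simp [connCoord, Fin.sum_univ_four]
    rw [show kron 0 0 = 1 by simp [kron], mul_one, mul_one] at h0
    set S := u y * ∑ m, hessCoord α β (fun i => frameDeriv b i u y)
        (fun p i => frameDeriv b p (frameDeriv b i u) y) m m
    refine mul_left_cancel₀ (mul_ne_zero two_ne_zero (hu0 y hy)) ?_
    simp only [hessCoord, hc0] at h h0
    rw [solvedHess]
    -- The Einstein constant, the Laplacian and |du|² only occur as multiples of the metric, so
    -- subtracting the (0,0) equation removes them.
    linear_combination h - kron i j * h0

end LieGroup

/-! ### Non-existence of a conformal Einstein metric, and the theorem. -/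

section LieGroup

variable {G : Type*} [TopologicalSpace G] [ChartedSpace E4 G] [Group G] [LieGroup (𝓡 4) ∞ G]
  {α β : ℝ} {b : Module.Basis (Fin 4) ℝ (GroupLieAlgebra (𝓡 4) G)}

lemma not_isLocallyConformallyEinstein_leftMetric (hb : IsStandardBasis α β b)
    (h₁ : α * β = -1 / 8) (h₂ : α ^ 2 + β ^ 2 = 7 / 8) :
    ¬ IsLocallyConformallyEinstein (leftMetric b) := by
  intro h
  obtain ⟨U, hU, h1, f, hf, hpos, hE⟩ := h 1
  obtain ⟨u, hu0, hu, l, hl⟩ := exists_conformal_factor_equation hb hU hf hpos hE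
  have hd (y) (hy : y ∈ U) :
      frameDeriv b 1 u y = 0 ∧ frameDeriv b 2 u y = 0 ∧ frameDeriv b 3 u y = 0 := by
    refine eq_zero_of_integrability (u := u y) (l := l y) (d := fun m => frameDeriv b m u y)
      (l' := fun m => frameDeriv b m l y) h₁ h₂ fun i j k => ?_
    have hderiv (p i j) : frameDeriv b p (frameDeriv b i (frameDeriv b j u)) y =
        solvedHessDeriv α β (u y) (l y) (fun m => frameDeriv b m u y)
          (fun m => frameDeriv b m l y) p i j := by
      rw [← frameDeriv_solvedHess (hu y hy) (hl y hy).1 (hl y hy).2]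
      refine frameDeriv_congr ?_ p
      filter_upwards [hU.mem_nhds hy] with z hz using (hl z hz).2 i j
    -- The integrability condition is the commutator of two frame fields acting on `e_k(u)`.
    rw [← hderiv, ← hderiv, frameDeriv_comm hb (contMDiffAt_frameDeriv (hu y hy) k)]
    simp only [(hl y hy).2]
  refine solvedHess_diag_false (l := l 1) (d := fun m => frameDeriv b m u 1) (hu0 1 h1) h₁ h₂
    (hd 1 h1) fun i hi => ?_
  -- For i ≠ 0, `e_i(u)` vanishes on all of `U`, hence so does its derivative at `1`.
  rw [← (hl 1 h1).2, frameDeriv, mvfderiv_eq_zero_of_eventuallyEq_const (c := 0), zero_apply]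
  filter_upwards [hU.mem_nhds h1] with z hz
  obtain ⟨hd1, hd2, hd3⟩ := hd z hz
  fin_cases i
  exacts [absurd rfl hi, hd1, hd2, hd3]

end LieGroup

theorem theorem1 {G : Type*} [TopologicalSpace G] [ChartedSpace E4 G] [Group G]
    [LieGroup (𝓡 4) ∞ G] [SimplyConnectedSpace G]
    (b : Module.Basis (Fin 4) ℝ (GroupLieAlgebra (𝓡 4) G))
    (hb : IsStandardBasis ((3 * √2 - √10) / 8) (-(3 * √2 + √10) / 8) b) :
    IsRiemannianMetric (leftMetric b) ∧
    IsOrthonormalFrameOn (leftMetric b) (leftFrame b) univ ∧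
    (∃ cov : ConnOp G, IsLeviCivitaOn (leftMetric b) cov univ ∧
      (∀ (i j : Fin 4) (x : G), bach (leftMetric b) cov (leftFrame b) i j x = 0) ∧
      (∃ (i j k l : Fin 4) (x : G),
        weylHalf 1 (leftMetric b) cov (leftFrame b) i j k l x ≠ 0) ∧
      (∃ (i j k l : Fin 4) (x : G),
        weylHalf (-1) (leftMetric b) cov (leftFrame b) i j k l x ≠ 0)) ∧
    ¬ IsLocallyConformallyEinstein (leftMetric b) := by
  have s2 : √2 ^ 2 = (2 : ℝ) := Real.sq_sqrt (by norm_num)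
  have s10 : √10 ^ 2 = (10 : ℝ) := Real.sq_sqrt (by norm_num)
  have h₁ : (3 * √2 - √10) / 8 * (-(3 * √2 + √10) / 8) = -1 / 8 := by
    linear_combination -9 / 64 * s2 + 1 / 64 * s10
  have h₂ : ((3 * √2 - √10) / 8) ^ 2 + (-(3 * √2 + √10) / 8) ^ 2 = 7 / 8 := by
    linear_combination 9 / 32 * s2 + 1 / 32 * s10
  generalize (3 * √2 - √10) / 8 = α at *
  generalize -(3 * √2 + √10) / 8 = β at *
  have hW {s : ℝ} (hs : s ^ 2 = 1) (x : G) :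
      weylHalf s (leftMetric b) (leftConn α β b) (leftFrame b) 0 2 0 2 x ≠ 0 := by
    rw [weylHalf_leftFrame hb h₁ h₂]
    -- If 1/8 + sβ/2 = 0 with s² = 1, then β² = 1/16, so αβ = -1/8 gives α² = 1/4 and α² + β² = 5/16
    -- ≠ 7/8.
    grind
  exact ⟨isRiemannianMetric_leftMetric b, isOrthonormalFrameOn_leftFrame b,
    ⟨leftConn α β b, isLeviCivitaOn_leftConn hb, bach_leftFrame hb h₁ h₂,
      ⟨0, 2, 0, 2, 1, hW (by norm_num) 1⟩, ⟨0, 2, 0, 2, 1, hW (by norm_num) 1⟩⟩,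
    not_isLocallyConformallyEinstein_leftMetric hb h₁ h₂⟩
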